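/- **Setting.** Let $(M,d)$ be a metric space of diameter $D$, normalized so that $1\le D<\infty$. An input consists of an initial state $s_0\in M$, cost functions $c_1,\dots,c_T:M\to[0,\infty]$, and the states $s_t^i$ ($1\le i\le \ell$, $0\le t\le T$, $s_0^i=s_0$) of $\ell\ge1$ heuristics, all fixed in advance. The heuristics' costs $f_t(i)=c_t(s_t^i)+d(s_{t-1}^i,s_t^i)$ are assumed to lie in $[0,2D]$. Let $$\mathrm{OPT}_{\le k}=\min_{i_1,\dots,i_T}\sum_{t=1}^T\big(c_t(s_t^{i_t})+d(s_{t-1}^{i_{t-1}},s_t^{i_t})\big),$$ the minimum being over sequences with at most $k$ indices $t\ge 2$ such that $i_{t-1}\ne i_t$. With $m$-delayed bandit access ($m\ge2$), the algorithm queries one heuristic per step $t=1,\dots,T$, and the query of $H_i$ at time $t$ reveals $s_t^i$ if and only if $H_i$ was queried in all of the steps $t-m+2,\dots,t$. **Learning dynamics** (exploration rate $\rho$, learning rate $\eta$, sharing parameter $\alpha$). Let $\beta_0=0$; let $\beta_t\sim\mathrm{Bernoulli}(\rho)$ and $e_t$ uniform on $\{1,\dots,\ell\}$ for $t\ge1$,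 all independent. Step $0$ is an exploitation step. If $t$ is an exploitation step and $\beta_t=0$, then $t+1$ is an exploitation step; if $\beta_t=1$, then $H_{e_{t+m}}$ is queried in steps $t+1,\dots,t+m$, step $t+m$ is an exploration step, and $t+m+1$ is an exploitation step. SHARE starts with weights $w(i)=1$. After an exploration step $t$ it receives the loss vector $g$ with $g(e_t)=f_t(e_t)/(2D)$ and $g(i)=0$ for $i\ne e_t$, and replaces $w(i)$ by $w(i)e^{-\eta g(i)}+\frac{\alpha}{\ell}\sum_j w(j)(1-e^{-\eta g(j)})$; no other step changes the weights. The vector $x_t$ is the normalized weight vector before step $t$. **Algorithm 2.** Choose $i_0$ uniformly at random. At time $t\ge 1$, if $x_t=x_{t-1}$, let $i_t=i_{t-1}$; otherwise let $i_t=j$ with probability $\tau_{i_{t-1},j}/x_{t-1}(i_{t-1})$, where $\tau$ is a transport plan from $x_{t-1}$ to $x_t$ that moves the least possible mass. In exploitation steps query $H_{i_t}$. If $s_t^{i_t}$ is known, go to $s_t=s_t^{i_t}$ and set $b_t=s_t$; otherwise set $b_t=b_{t-1}$ (with $b_0=s_0$) and go to some $s_t\in\arg\min_{s\in M}(d(b_t,s)+c_t(s))$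 (assumed to exist). The cost is $\mathrm{ALG}=\sum_{t=1}^T(c_t(s_t)+d(s_{t-1},s_t))$. For a given $k\ge1$ the parameters are tuned as $$\rho=\frac{(D\ell k)^{1/3}}{m^{4/3}\,\mathrm{OPT}_{\le k}^{1/3}},\qquad \alpha=\frac{D\ell k}{\rho\,\mathrm{OPT}_{\le k}},\qquad \gamma=\sqrt{\alpha},\qquad \eta=\ln\frac1{1-\gamma}.$$ **Claim.** In the regime $D\ell m\le o(\mathrm{OPT}_{\le k}^{1/3})$, Algorithm 2 with SHARE is $(1+\varepsilon)$-competitive against $\mathrm{OPT}_{\le k}$ for $k$ as large as $\Omega\big(\varepsilon^3\mathrm{OPT}_{\le k}/(D\ell m^2(\ln Z)^3)\big)$. Precisely, there are absolute constants $c_0,c>0$ such that for all such inputs, all integers $\ell\ge 1$, $m\ge2$, $k\ge1$, every $\varepsilon\in(0,1]$, and every choice of minimizers and optimal transport plans in the algorithm: if $$D\ell m\le c_0\,\mathrm{OPT}_{\le k}^{1/3}\qquad\text{and}\qquad k\le c\,\frac{\varepsilon^3\,\mathrm{OPT}_{\le k}}{D\ell m^2(\ln Z)^3},\qquad Z=\frac{\ell^{1/3}\,\mathrm{OPT}_{\le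 k}^{2/3}}{D^{2/3}m^{4/3}},$$ then the parameters are admissible ($0<\rho\le1$, $0<\alpha\le\frac12$, $\eta>0$) and $$\mathbb E[\mathrm{ALG}]\le(1+\varepsilon)\,\mathrm{OPT}_{\le k}.$$ -/

import Mathlib

open scoped ENNReal

noncomputable section

namespace MTS

/-! ### Metrical task systems with heuristics and the benchmark -/

/-- An input of a metrical task system on the metric space `M` together with the solutions of
`ℓ` heuristics (all fixed in advance, the adversary being oblivious). Only the values
`cost t`, `1 ≤ t ≤ T`, and `state t`, `0 ≤ t ≤ T`, matter. Costs may be infinite at some states;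
each heuristic pays at most twice the diameter in every step. -/
structure Input (M : Type*) [MetricSpace M] (ℓ : ℕ) where
  /-- number of time steps -/
  T : ℕ
  /-- the cost function `c_t` -/
  cost : ℕ → M → ℝ≥0∞
  /-- the common initial state -/
  start : M
  /-- the state of heuristic `i` at time `t` -/
  state : ℕ → Fin ℓ → M
  state_zero : ∀ i, state 0 i = start
  step_le : ∀ t < T, ∀ i,
    cost (t + 1) (state (t + 1) i) + edist (state t i) (state (t + 1) i)
      ≤ ENNReal.ofReal (2 * Metric.diam (Set.univ : Set M))

/-- The diameter `D` of the metric space. -/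
def diameter (M : Type*) [MetricSpace M] : ℝ := Metric.diam (Set.univ : Set M)

variable {M : Type*} [MetricSpace M] {ℓ : ℕ}

/-- `f_t(i)`: the cost incurred by heuristic `i` at time `t ≥ 1`. -/
def Input.heuristicCost (I : Input M ℓ) (t : ℕ) (i : Fin ℓ) : ℝ≥0∞ :=
  I.cost t (I.state t i) + edist (I.state (t - 1) i) (I.state t i)

/-- The cost of being, at each time `t = 1, …, T`, in the state of heuristic `a t`
(at time `0` all heuristics are in the same state). -/
def Input.combinationCost (I : Input M ℓ) (a : ℕ → Fin ℓ) : ℝ≥0∞ :=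
  ∑ t ∈ Finset.Icc 1 I.T,
    (I.cost t (I.state t (a t)) + edist (I.state (t - 1) (a (t - 1))) (I.state t (a t)))

/-- The number of switches of `a 1, …, a T`. -/
def switches (T : ℕ) (a : ℕ → Fin ℓ) : ℕ :=
  ((Finset.Icc 2 T).filter fun t => a (t - 1) ≠ a t).card

/-- `OPT_{≤ k}`: the cost of the best combination of the heuristics with at most `k` switches. -/
def Input.opt (I : Input M ℓ) (k : ℕ) : ℝ :=
  (⨅ (a : ℕ → Fin ℓ) (_ : switches I.T a ≤ k), I.combinationCost a).toReal

/-! ### SHARE -/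

/-- One update of the weights of SHARE with learning rate `η` and sharing parameter `α`
after the loss vector `g`. -/
def shareUpdate (η α : ℝ) (g w : Fin ℓ → ℝ) : Fin ℓ → ℝ := fun i =>
  w i * Real.exp (-η * g i) + α * (∑ j, (w j - w j * Real.exp (-η * g j))) / ℓ

/-! ### Learning dynamics: exploration, exploitation and the fractional solution -/

/-- The schedule determined by the coins `β` (with `β 0 = false`). The value is `0` if `t` is an
exploitation step. If `t` is an exploitation step with `β t = true`, then the values at
`t + 1, …, t + m` are `m, …, 1`; the step `t + m`, with value `1`, is the exploration step, and
`t + m + 1` is again an exploitation step. -/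
def countdown (m : ℕ) (β : ℕ → Bool) : ℕ → ℕ
  | 0 => 0
  | t + 1 => if countdown m β t = 0 then (if β t then m else 0) else countdown m β t - 1

/-- The loss vector fed to the learning algorithm in the exploration step `t`: the cost of the
explored heuristic `e t`, scaled by `1 / (2D)`, and `0` for the other heuristics. -/
def Input.feedback (I : Input M ℓ) (e : ℕ → Fin ℓ) (t : ℕ) : Fin ℓ → ℝ := fun i =>
  if i = e t then (I.heuristicCost t (e t)).toReal / (2 * diameter M) else 0

/-- The weights of SHARE before time `t`; they are updated after exploration steps only. -/
def Input.weights (I : Input M ℓ) (m : ℕ) (η α : ℝ) (β : ℕ → Bool) (e : ℕ → Fin ℓ) :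
    ℕ → Fin ℓ → ℝ
  | 0 => fun _ => 1
  | t + 1 =>
    if countdown m β t = 1 then shareUpdate η α (I.feedback e t) (I.weights m η α β e t)
    else I.weights m η α β e t

/-- The fractional solution `x_t`, a distribution over the heuristics. -/
def Input.fractional (I : Input M ℓ) (m : ℕ) (η α : ℝ) (β : ℕ → Bool) (e : ℕ → Fin ℓ)
    (t : ℕ) : Fin ℓ → ℝ := fun i =>
  I.weights m η α β e t i / ∑ j, I.weights m η α β e t j

/-! ### Rounding -/

/-- `τ i j` is the mass moved from `p i` to `p' j` by an optimal transport of `p` to `p'`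
(for the discrete metric). -/
structure IsTransport (p p' : Fin ℓ → ℝ) (τ : Fin ℓ → Fin ℓ → ℝ) : Prop where
  nonneg : ∀ i j, 0 ≤ τ i j
  row : ∀ i, ∑ j, τ i j = p i
  col : ∀ j, ∑ i, τ i j = p' j
  moved : ∑ i, ∑ j ∈ Finset.univ.erase i, τ i j = ∑ i, max 0 (p i - p' i)

/-- A choice of an optimal transport for every pair of distributions. -/
def IsRounding (τ : (Fin ℓ → ℝ) → (Fin ℓ → ℝ) → Fin ℓ → Fin ℓ → ℝ) : Prop :=
  ∀ p ∈ stdSimplex ℝ (Fin ℓ), ∀ p' ∈ stdSimplex ℝ (Fin ℓ), IsTransport p p' (τ p p')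

/-- The probability that the exploited heuristic changes from `i` to `j` when the fractional
solution changes from `p` to `p'`. -/
def transition (τ : (Fin ℓ → ℝ) → (Fin ℓ → ℝ) → Fin ℓ → Fin ℓ → ℝ) (p p' : Fin ℓ → ℝ)
    (i j : Fin ℓ) : ℝ :=
  if p' ≠ p then τ p p' i j / p i else if j = i then 1 else 0

/-! ### Producing the solution of the metrical task system -/

/-- The heuristic queried at time `t`: the exploited heuristic `a t` in an exploitation step;
otherwise, the heuristic to be explored at the end of the current block of `m` steps. -/
def query (m : ℕ) (β : ℕ → Bool) (e a : ℕ → Fin ℓ) (t : ℕ) : Fin ℓ :=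
  if countdown m β t = 0 then a t else e (t + countdown m β t - 1)

/-- `m`-delayed bandit access: the state of heuristic `i` at time `t` is known if and only if `i`
was queried in all the steps `t - m + 2, …, t` (queries start at time `1`). -/
def Known (m : ℕ) (q : ℕ → Fin ℓ) (i : Fin ℓ) (t : ℕ) : Prop :=
  m ≤ t + 1 ∧ ∀ u ∈ Finset.Icc (t + 2 - m) t, q u = i

instance (m : ℕ) (q : ℕ → Fin ℓ) (i : Fin ℓ) (t : ℕ) : Decidable (Known m q i t) :=
  inferInstanceAs (Decidable (_ ∧ _))

/-- `greedy t b` minimizes `d(b, s) + c_t(s)` over the states `s`; ties are broken arbitrarily. -/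
def Input.IsGreedy (I : Input M ℓ) (greedy : ℕ → M → M) : Prop :=
  ∀ t ∈ Finset.Icc 1 I.T, ∀ b s,
    edist b (greedy t b) + I.cost t (greedy t b) ≤ edist b s + I.cost t s

/-- The last known state `b_t` of an exploited heuristic, for the query sequence `q` and the
sequence `a` of exploited heuristics. -/
def Input.lastKnown (I : Input M ℓ) (m : ℕ) (q a : ℕ → Fin ℓ) : ℕ → M
  | 0 => I.start
  | t + 1 => if Known m q (a (t + 1)) (t + 1) then I.state (t + 1) (a (t + 1))
      else I.lastKnown m q a t

/-- The state `s_t` of the algorithm: the state of the exploited heuristic if it is known, and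
otherwise the result of a greedy step from the last known state. -/
def Input.position (I : Input M ℓ) (m : ℕ) (greedy : ℕ → M → M) (q a : ℕ → Fin ℓ) : ℕ → M
  | 0 => I.start
  | t + 1 => if Known m q (a (t + 1)) (t + 1) then I.state (t + 1) (a (t + 1))
      else greedy (t + 1) (I.lastKnown m q a (t + 1))

/-- The cost of the algorithm for given outcomes of all random choices. -/
def Input.algCost (I : Input M ℓ) (m : ℕ) (greedy : ℕ → M → M) (β : ℕ → Bool)
    (e a : ℕ → Fin ℓ) : ℝ≥0∞ :=
  ∑ t ∈ Finset.Icc 1 I.T,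
    (I.cost t (I.position m greedy (query m β e a) a t) +
      edist (I.position m greedy (query m β e a) a (t - 1))
        (I.position m greedy (query m β e a) a t))

/-! ### The expected cost -/

/-- The sequence with the terms `v 0, …, v (n - 1)` at the times `0, …, n - 1`. -/
def fromZero {A : Type*} [Inhabited A] {n : ℕ} (v : Fin n → A) (t : ℕ) : A :=
  if h : t < n then v ⟨t, h⟩ else default

/-- The sequence with the terms `v 0, …, v (n - 1)` at the times `1, …, n`. For `A = Bool`, the
term at time `0` is `false`. -/
def fromOne {A : Type*} [Inhabited A] {n : ℕ} (v : Fin n → A) : ℕ → A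
  | 0 => default
  | t + 1 => fromZero v t

/-- The probability of the outcome `(β, e, a)`: the coins `β_1, …, β_T` are independent
Bernoulli variables with parameter `ρ`, the heuristics to be explored are independent and uniform,
the first exploited heuristic `a_0` is uniform, and `a_t` is obtained from `a_{t-1}` by rounding.
(A block that starts before time `T` may end after it, by less than `m + 1` steps.) -/
def Input.prob [NeZero ℓ] (I : Input M ℓ) (m : ℕ) (ρ η α : ℝ)
    (τ : (Fin ℓ → ℝ) → (Fin ℓ → ℝ) → Fin ℓ → Fin ℓ → ℝ)
    (β : Fin I.T → Bool) (e : Fin (I.T + m) → Fin ℓ) (a : Fin (I.T + 1) → Fin ℓ) : ℝ :=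
  (∏ t, if β t then ρ else 1 - ρ) * (∏ _t : Fin (I.T + m), (1 / ℓ : ℝ)) * (1 / ℓ : ℝ) *
    ∏ t ∈ Finset.Icc 1 I.T,
      transition τ (I.fractional m η α (fromOne β) (fromOne e) (t - 1))
        (I.fractional m η α (fromOne β) (fromOne e) t) (fromZero a (t - 1)) (fromZero a t)

/-- The expected cost of the algorithm with exploration rate `ρ`, which uses SHARE with learning
rate `η` and sharing parameter `α`, with `m`-delayed bandit access to the heuristics. -/
def Input.expectedCost [NeZero ℓ] (I : Input M ℓ) (m : ℕ) (ρ η α : ℝ)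
    (τ : (Fin ℓ → ℝ) → (Fin ℓ → ℝ) → Fin ℓ → Fin ℓ → ℝ) (greedy : ℕ → M → M) : ℝ≥0∞ :=
  ∑ β : Fin I.T → Bool, ∑ e : Fin (I.T + m) → Fin ℓ, ∑ a : Fin (I.T + 1) → Fin ℓ,
    ENNReal.ofReal (I.prob m ρ η α τ β e a) *
      I.algCost m greedy (fromOne β) (fromOne e) (fromZero a)

/-! ### The choice of the parameters -/

/-- The exploration rate `OPT^{-1/3} (D ℓ k)^{1/3} m^{-4/3}`. -/
def exploreRate (D : ℝ) (ℓ m k : ℕ) (OPT : ℝ) : ℝ :=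
  OPT ^ (-(1 / 3) : ℝ) * (D * ℓ * k) ^ (1 / 3 : ℝ) * (m : ℝ) ^ (-(4 / 3) : ℝ)

/-- The sharing parameter `α = D ℓ k / (ρ OPT)`, where `ρ` is the exploration rate. -/
def shareParam (D : ℝ) (ℓ m k : ℕ) (OPT : ℝ) : ℝ :=
  D * ℓ * k / (exploreRate D ℓ m k OPT * OPT)

/-- The parameter `γ = √(D ℓ k / (ρ OPT))`. -/
def gammaParam (D : ℝ) (ℓ m k : ℕ) (OPT : ℝ) : ℝ :=
  √(D * ℓ * k / (exploreRate D ℓ m k OPT * OPT))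

/-- The learning rate `η = ln (1 / (1 - γ))`. -/
def learningRate (D : ℝ) (ℓ m k : ℕ) (OPT : ℝ) : ℝ :=
  Real.log (1 / (1 - gammaParam D ℓ m k OPT))

/-- `Z = ℓ^{1/3} OPT^{2/3} / (D^{2/3} m^{4/3})`. -/
def logArg (D : ℝ) (ℓ m : ℕ) (OPT : ℝ) : ℝ :=
  (ℓ : ℝ) ^ (1 / 3 : ℝ) * OPT ^ (2 / 3 : ℝ) / (D ^ (2 / 3 : ℝ) * (m : ℝ) ^ (4 / 3 : ℝ))

end MTS

end

/-! Notation: `O` is the benchmark, `x_t` the distribution of SHARE, `C` the expected value of the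
sum of `⟨x_t, f_t⟩` over all steps, `A` the part of this sum that falls in exploration steps, and
`N` the expected mass moved by `x`. The tuning means `γ = ρ m²`, `α = γ²`, `1 - exp (-η) = γ` and
`ρ³ m⁴ O = D ℓ k`.

Learning. Comparing the decrease of the total weight of SHARE with what a switching comparator must
retain gives a regret bound with a multiplicative error (`shareSeq_regret`), and the mass moved in a
step is at most `η` times the loss suffered (`moved_shareUpdate_le`). The explored heuristic is
uniform and independent of `x_t`, so the expected losses of SHARE add up to `A / (2 D ℓ)`, while a
comparator of cost `F` loses at most `ρ F / (2 D ℓ)`. Hence `A` is at most about `ρ O`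
(`Input.coinExp_regret`), and `N ≤ η A / (2 D ℓ)` (`Input.coinExp_movement_le`).

From exploration steps to all steps. Step `t` is an exploration step exactly if `t - m` is an
exploitation step whose coin fires, and that coin is independent of the past. The dependence between
`x_t` and earlier coins is broken by passing to the distribution of `2 m` steps earlier, at a price
of `2 D` times the mass moved since. This yields `ρ (1 - ρ m) C ≤ A` up to small terms
(`Input.sum_coinExp_staleCost_le`).

The actual algorithm. Rounding gives the exploited heuristic the law `x_t` and makes its switching
probability the mass moved. Its state can be unknown only if a coin fired in the last `2 m` steps,
the exploited heuristic switched in the last `m` steps, or the process is starting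
(`recentCoin_or_unsettled`). The distance from the last known state is therefore bounded by a
recursively defined `debt`, which is linear in the overhead and loses its past when there was no
recent coin; five times the total debt covers the excess cost (`Input.algCost_le`). As coins are
rare, overhead survives only `O(m)` steps in expectation, which a potential argument makes precise
(`sum_coinExp_damped_le`).

All errors combine to `O(γ log Z) O` (`competitive_bound`). The bound on `k` says exactly that `γ
log Z ≤ ε / 210`, and the regime assumption absorbs the start-up cost. -/

noncomputable section

namespace MTS

/-! ### Finite product distributions and finite Markov chains -/

/-- Resampling one coordinate of a finite product distribution. -/
theorem sum_prod_resample {ι A : Type*} [Fintype ι] [DecidableEq ι] [Fintype A]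
    (p : ι → A → ℝ) (i : ι) (hp : ∑ a, p i a = 1) (G : (ι → A) → ℝ) :
    ∑ v, (∏ j, p j (v j)) * G v
      = ∑ v : ι → A, (∏ j, p j (v j)) * ∑ a, p i a * G (Function.update v i a) := by
  classical
  have h1 : ∑ v : ι → A, (∏ j, p j (v j)) * ∑ a, p i a * G (Function.update v i a)
      = ∑ q : (ι → A) × A, (∏ j, p j (q.1 j)) * (p i q.2 * G (Function.update q.1 i q.2)) := by
    rw [Fintype.sum_prod_type]
    exact Finset.sum_congr rfl fun v _ => Finset.mul_sum _ _ _
  have h2 : ∑ v : ι → A, (∏ j, p j (v j)) * G v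
      = ∑ q : (ι → A) × A, (∏ j, p j (q.1 j)) * (p i q.2 * G q.1) := by
    rw [Fintype.sum_prod_type]
    refine Finset.sum_congr rfl fun v _ => ?_
    simp only [← Finset.mul_sum, ← Finset.sum_mul, hp, one_mul]
  rw [h1, h2]
  -- Exchanging the coordinate with the fresh sample is an involution that preserves the joint
  -- weight.
  let swap : (ι → A) × A ≃ (ι → A) × A :=
    { toFun := fun q => (Function.update q.1 i q.2, q.1 i)
      invFun := fun q => (Function.update q.1 i q.2, q.1 i)
      left_inv := fun q => by simp
      right_inv := fun q => by simp }
  refine (Fintype.sum_equiv swap _ _ fun q => ?_).symm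
  have h3 : ∀ v : ι → A, ∏ j, p j (v j) = p i (v i) * ∏ j ∈ Finset.univ.erase i, p j (v j) :=
    fun v => (Finset.mul_prod_erase _ _ (Finset.mem_univ i)).symm
  have h4 : ∏ j ∈ Finset.univ.erase i, p j (Function.update q.1 i q.2 j)
      = ∏ j ∈ Finset.univ.erase i, p j (q.1 j) :=
    Finset.prod_congr rfl fun j hj => by
      rw [Function.update_of_ne (Finset.ne_of_mem_erase hj)]
  simp only [swap, Equiv.coe_fn_mk]
  rw [h3, h3, h4, Function.update_self]
  ring

theorem sum_prod_eq_one {ι A : Type*} [Fintype ι] [DecidableEq ι] [Fintype A]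
    (p : ι → A → ℝ) (hp : ∀ i, ∑ a, p i a = 1) : ∑ v : ι → A, ∏ j, p j (v j) = 1 := by
  rw [← Fintype.prod_sum]; simp [hp]

theorem sum_snoc {A : Type*} [Fintype A] (n : ℕ) (H : (Fin (n + 1) → A) → ℝ) :
    ∑ a, H a = ∑ a : Fin n → A, ∑ b, H (Fin.snoc a b) := by
  rw [Finset.sum_comm, ← Fintype.sum_prod_type']
  exact (Fintype.sum_equiv (Fin.snocEquiv fun _ => A) _ _ fun q => rfl).symm

theorem fromZero_snoc_of_lt {A : Type*} [Inhabited A] {n t : ℕ} (a : Fin n → A) (b : A)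
    (h : t < n) : fromZero (Fin.snoc a b : Fin (n + 1) → A) t = fromZero a t := by
  have : (⟨t, h.trans n.lt_succ_self⟩ : Fin (n + 1)) = Fin.castSucc ⟨t, h⟩ := rfl
  simp only [fromZero, h, h.trans n.lt_succ_self, dif_pos, this, Fin.snoc_castSucc]

theorem fromZero_snoc_self {A : Type*} [Inhabited A] {n : ℕ} (a : Fin n → A) (b : A) :
    fromZero (Fin.snoc a b : Fin (n + 1) → A) n = b := by
  have : (⟨n, n.lt_succ_self⟩ : Fin (n + 1)) = Fin.last n := rfl
  simp only [fromZero, n.lt_succ_self, dif_pos, this, Fin.snoc_last]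

/-- The weight of a path of a Markov chain. -/
def pathWeight {A : Type*} (μ : A → ℝ) (P : ℕ → A → A → ℝ) (n : ℕ) (a : ℕ → A) : ℝ :=
  μ (a 0) * ∏ t ∈ Finset.Icc 1 n, P t (a (t - 1)) (a t)

theorem pathWeight_congr {A : Type*} (μ : A → ℝ) (P : ℕ → A → A → ℝ) (n : ℕ) {a a' : ℕ → A}
    (h : ∀ t ≤ n, a t = a' t) : pathWeight μ P n a = pathWeight μ P n a' := by
  unfold pathWeight
  rw [h 0 (Nat.zero_le n)]
  congr 1
  refine Finset.prod_congr rfl fun t ht => ?_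
  rw [Finset.mem_Icc] at ht
  rw [h t ht.2, h (t - 1) (by omega)]

theorem sum_pathWeight_succ {A : Type*} [Inhabited A] [Fintype A] (μ : A → ℝ)
    (P : ℕ → A → A → ℝ) (n : ℕ) (H : (Fin (n + 2) → A) → ℝ) :
    ∑ a : Fin (n + 2) → A, pathWeight μ P (n + 1) (fromZero a) * H a
      = ∑ a : Fin (n + 1) → A, pathWeight μ P n (fromZero a) *
          ∑ b, P (n + 1) (fromZero a n) b * H (Fin.snoc a b) := by
  rw [sum_snoc]
  refine Finset.sum_congr rfl fun a _ => ?_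
  rw [Finset.mul_sum]
  refine Finset.sum_congr rfl fun b _ => ?_
  have h1 : pathWeight μ P (n + 1) (fromZero (Fin.snoc a b : Fin (n + 2) → A))
      = pathWeight μ P n (fromZero a) * P (n + 1) (fromZero a n) b := by
    rw [← pathWeight_congr μ P n fun t ht =>
      fromZero_snoc_of_lt a b (Nat.lt_succ_of_le ht)]
    unfold pathWeight
    rw [Finset.prod_Icc_succ_top (by omega), fromZero_snoc_self, Nat.add_sub_cancel,
      fromZero_snoc_of_lt a b n.lt_succ_self]
    ring
  rw [h1, mul_assoc]

section Chain

variable {A : Type*} [Inhabited A] [Fintype A] {P : ℕ → A → A → ℝ} {x : ℕ → A → ℝ}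

/-- The last transition is absorbed into the test function. Since `P` carries `x t` to `x (t + 1)`,
the law of the chain at time `n` is `x n`. -/
theorem sum_path_last (hx : ∀ t j, ∑ i, x t i * P (t + 1) i j = x (t + 1) j) (n : ℕ)
    (h : A → ℝ) :
    ∑ a : Fin (n + 1) → A, pathWeight (x 0) P n (fromZero a) * h (fromZero a n)
      = ∑ i, x n i * h i := by
  induction n generalizing h with
  | zero =>
    refine Fintype.sum_equiv (Equiv.funUnique (Fin 1) A) _ _ fun a => ?_
    simp [pathWeight, fromZero]
  | succ n ih =>
    rw [sum_pathWeight_succ]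
    simp only [fromZero_snoc_self]
    rw [ih fun i => ∑ b, P (n + 1) i b * h b]
    simp only [Finset.mul_sum, ← hx n, Finset.sum_mul]
    rw [Finset.sum_comm]
    simp only [mul_assoc]

/-- Transitions after time `s + 1` sum to one by `hrow`; what precedes time `s` is handled by
`sum_path_last`. -/
theorem sum_path_pair (hx : ∀ t j, ∑ i, x t i * P (t + 1) i j = x (t + 1) j)
    (hrow : ∀ t i, ∑ j, P (t + 1) i j = 1) {n s : ℕ} (hs : s < n) (g : A → A → ℝ) :
    ∑ a : Fin (n + 1) → A,
        pathWeight (x 0) P n (fromZero a) * g (fromZero a s) (fromZero a (s + 1))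
      = ∑ i, ∑ j, x s i * P (s + 1) i j * g i j := by
  induction n with
  | zero => omega
  | succ n ih =>
    rw [sum_pathWeight_succ]
    rcases Nat.lt_succ_iff_lt_or_eq.1 hs with h | rfl
    · rw [← ih h]
      refine Finset.sum_congr rfl fun a _ => ?_
      simp only [fromZero_snoc_of_lt a _ (show s < n + 1 by omega),
        fromZero_snoc_of_lt a _ (show s + 1 < n + 1 by omega)]
      rw [← Finset.sum_mul, hrow, one_mul]
    · simp only [fromZero_snoc_self, fromZero_snoc_of_lt _ _ (Nat.lt_succ_self s)]
      rw [sum_path_last hx s fun i => ∑ b, P (s + 1) i b * g i b]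
      simp only [Finset.mul_sum, mul_assoc]

theorem sum_path_eq_one (hx : ∀ t j, ∑ i, x t i * P (t + 1) i j = x (t + 1) j)
    (hsum : ∀ t, ∑ i, x t i = 1) (n : ℕ) :
    ∑ a : Fin (n + 1) → A, pathWeight (x 0) P n (fromZero a) = 1 := by
  simpa [hsum] using sum_path_last hx n fun _ => 1

theorem sum_path_single (hx : ∀ t j, ∑ i, x t i * P (t + 1) i j = x (t + 1) j)
    (hrow : ∀ t i, ∑ j, P (t + 1) i j = 1) {n s : ℕ} (hs : s < n) (h : A → ℝ) :
    ∑ a : Fin (n + 1) → A, pathWeight (x 0) P n (fromZero a) * h (fromZero a (s + 1))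
      = ∑ i, x (s + 1) i * h i := by
  rw [sum_path_pair hx hrow hs fun _ j => h j, Finset.sum_comm]
  simp only [← hx s, Finset.sum_mul]

end Chain

/-! ### The regret and the movement of SHARE -/

section Share

variable {ℓ : ℕ} {η α : ℝ} {g w : Fin ℓ → ℝ}

/-- The mass moved from `p` to `p'` by an optimal transport. -/
def moved (p p' : Fin ℓ → ℝ) : ℝ := ∑ i, max 0 (p i - p' i)

theorem moved_nonneg (p p' : Fin ℓ → ℝ) : 0 ≤ moved p p' :=
  Finset.sum_nonneg fun _ _ => le_max_left _ _

/-- The total weight removed by the losses. -/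
def removed (η : ℝ) (g w : Fin ℓ → ℝ) : ℝ := ∑ j, (w j - w j * Real.exp (-η * g j))

theorem mul_one_sub_exp_nonneg (hη : 0 ≤ η) (hg : ∀ i, 0 ≤ g i) (hw : ∀ i, 0 ≤ w i) (i : Fin ℓ) :
    0 ≤ w i - w i * Real.exp (-η * g i) := by
  have h : Real.exp (-η * g i) ≤ 1 := Real.exp_le_one_iff.2 (by nlinarith [hg i])
  nlinarith [hw i]

theorem removed_nonneg (hη : 0 ≤ η) (hg : ∀ i, 0 ≤ g i) (hw : ∀ i, 0 ≤ w i) :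
    0 ≤ removed η g w :=
  Finset.sum_nonneg fun i _ => mul_one_sub_exp_nonneg hη hg hw i

theorem moved_comm {p p' : Fin ℓ → ℝ} (h : ∑ i, p i = ∑ i, p' i) : moved p p' = moved p' p := by
  have key : ∀ i, max 0 (p i - p' i) = max 0 (p' i - p i) + (p i - p' i) := fun i => by
    rcases le_total (p i) (p' i) with h | h
    · rw [max_eq_left (by linarith), max_eq_right (by linarith)]; ring
    · rw [max_eq_right (by linarith), max_eq_left (by linarith)]; ring
  simp only [moved, key, Finset.sum_add_distrib, Finset.sum_sub_distrib, h, sub_self, add_zero]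

theorem moved_triangle (p q r : Fin ℓ → ℝ) : moved p r ≤ moved p q + moved q r := by
  rw [moved, moved, moved, ← Finset.sum_add_distrib]
  refine Finset.sum_le_sum fun i _ => max_le (by positivity) ?_
  have := le_max_right 0 (p i - q i)
  have := le_max_right 0 (q i - r i)
  linarith

theorem moved_self (p : Fin ℓ → ℝ) : moved p p = 0 := by simp [moved]

theorem moved_le_sum (x : ℕ → Fin ℓ → ℝ) {s t : ℕ} (h : s ≤ t) :
    moved (x s) (x t) ≤ ∑ u ∈ Finset.Ioc s t, moved (x (u - 1)) (x u) := by
  induction t, h using Nat.le_induction with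
  | base => simp [moved_self]
  | succ t h ih =>
    rw [Finset.sum_Ioc_succ_top h]
    exact (moved_triangle _ (x t) _).trans (by simpa using ih)

theorem sum_mul_le_add_moved {p p' F : Fin ℓ → ℝ} {B : ℝ} (hF : ∀ i, 0 ≤ F i)
    (hF1 : ∀ i, F i ≤ B) : ∑ i, p i * F i ≤ ∑ i, p' i * F i + B * moved p p' := by
  rw [moved, Finset.mul_sum, ← Finset.sum_add_distrib]
  refine Finset.sum_le_sum fun i _ => ?_
  have h1 := le_max_right 0 (p i - p' i)
  have h2 := le_max_left 0 (p i - p' i)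
  nlinarith [hF i, hF1 i]

theorem shareUpdate_zero : shareUpdate η α (fun _ => 0) w = w := by
  funext i; simp [shareUpdate]

/-- Convexity: on the segment from `-η` to `0` the exponential lies below its chord. -/
theorem one_sub_exp_mul_le {s : ℝ} (hs : 0 ≤ s) (hs1 : s ≤ 1) :
    (1 - Real.exp (-η)) * s ≤ 1 - Real.exp (-η * s) := by
  have h := convexOn_exp.2 (Set.mem_univ (-η)) (Set.mem_univ 0) hs (sub_nonneg.2 hs1) (by ring)
  simp only [smul_eq_mul, mul_zero, add_zero, Real.exp_zero, mul_one] at h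
  rw [mul_comm s (-η)] at h
  linarith

theorem removed_ge (hg : ∀ i, 0 ≤ g i) (hg1 : ∀ i, g i ≤ 1) (hw : ∀ i, 0 ≤ w i) :
    (1 - Real.exp (-η)) * ∑ i, w i * g i ≤ removed η g w := by
  unfold removed
  rw [Finset.mul_sum]
  refine Finset.sum_le_sum fun i _ => ?_
  have := one_sub_exp_mul_le (η := η) (hg i) (hg1 i)
  nlinarith [hw i]

theorem mul_exp_le_shareUpdate (hη : 0 ≤ η) (hα : 0 ≤ α) (hg : ∀ i, 0 ≤ g i)
    (hw : ∀ i, 0 ≤ w i) (i : Fin ℓ) :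
    w i * Real.exp (-η * g i) ≤ shareUpdate η α g w i := by
  have := removed_nonneg hη hg hw
  unfold removed at this
  unfold shareUpdate
  have h2 : 0 ≤ α * (∑ j, (w j - w j * Real.exp (-η * g j))) / ℓ := by positivity
  linarith

theorem switches_succ_of_ne (T : ℕ) (a : ℕ → Fin ℓ) (h : a (T + 1) ≠ a (T + 2)) :
    switches (T + 2) a = switches (T + 1) a + 1 := by
  unfold switches
  have hI : Finset.Icc 2 (T + 2) = insert (T + 2) (Finset.Icc 2 (T + 1)) := by
    ext; simp only [Finset.mem_Icc, Finset.mem_insert]; omega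
  rw [hI, Finset.filter_insert, if_pos (by simpa using h), Finset.card_insert_of_notMem (by simp)]

theorem switches_succ_of_eq (T : ℕ) (a : ℕ → Fin ℓ) (h : a (T + 1) = a (T + 2)) :
    switches (T + 2) a = switches (T + 1) a := by
  unfold switches
  have hI : Finset.Icc 2 (T + 2) = insert (T + 2) (Finset.Icc 2 (T + 1)) := by
    ext; simp only [Finset.mem_Icc, Finset.mem_insert]; omega
  rw [hI, Finset.filter_insert, if_neg (by simpa using h)]

theorem switches_succ_le (T : ℕ) (a : ℕ → Fin ℓ) : switches (T + 1) a ≤ switches T a + 1 := by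
  rcases T with _ | T
  · simp [switches]
  · by_cases h : a (T + 1) = a (T + 2)
    · rw [switches_succ_of_eq T a h]; omega
    · rw [switches_succ_of_ne T a h]

theorem shareUpdate_pos (hη : 0 ≤ η) (hα : 0 ≤ α) (hg : ∀ i, 0 ≤ g i) (hw : ∀ i, 0 < w i)
    (i : Fin ℓ) : 0 < shareUpdate η α g w i :=
  (mul_pos (hw i) (Real.exp_pos _)).trans_le
    (mul_exp_le_shareUpdate hη hα hg (fun i => (hw i).le) i)

variable {G u : ℕ → Fin ℓ → ℝ}

theorem shareSeq_pos (hη : 0 ≤ η) (hα : 0 ≤ α) (hG : ∀ t i, 0 ≤ G t i) (h0 : ∀ i, 0 < u 0 i)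
    (hu : ∀ t, u (t + 1) = shareUpdate η α (G t) (u t)) (t : ℕ) : ∀ i, 0 < u t i := by
  induction t with
  | zero => exact h0
  | succ t ih => rw [hu]; exact shareUpdate_pos hη hα (hG t) ih

variable [NeZero ℓ]

theorem sum_shareUpdate : ∑ i, shareUpdate η α g w i = ∑ i, w i - (1 - α) * removed η g w := by
  have hℓ : (ℓ : ℝ) ≠ 0 := Nat.cast_ne_zero.2 (NeZero.ne ℓ)
  have h : ∑ i, w i * Real.exp (-η * g i) = ∑ i, w i - removed η g w := by
    simp [removed, Finset.sum_sub_distrib]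
  simp only [shareUpdate, Finset.sum_add_distrib, h, Finset.sum_const, Finset.card_univ,
    Fintype.card_fin, nsmul_eq_mul]
  rw [mul_div_cancel₀ _ hℓ]
  unfold removed
  ring

/-- A weight shrinks at most by the factor `exp (-η g i) ≥ 1 - η g i`, and the normalizing total
does not grow, so each probability falls by at most `η g i` times itself. -/
theorem moved_shareUpdate_le (hη : 0 ≤ η) (hα : 0 ≤ α) (hα1 : α ≤ 1) (hg : ∀ i, 0 ≤ g i)
    (hw : ∀ i, 0 < w i) :
    moved (fun i => w i / ∑ j, w j)
        (fun i => shareUpdate η α g w i / ∑ j, shareUpdate η α g w j)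
      ≤ η * ∑ i, w i / (∑ j, w j) * g i := by
  have hw0 : ∀ i, 0 ≤ w i := fun i => (hw i).le
  have hW : 0 < ∑ j, w j := Finset.sum_pos (fun i _ => hw i) Finset.univ_nonempty
  have hW' : 0 < ∑ j, shareUpdate η α g w j :=
    Finset.sum_pos (fun i _ => shareUpdate_pos hη hα hg hw i) Finset.univ_nonempty
  have hle : ∑ j, shareUpdate η α g w j ≤ ∑ j, w j := by
    rw [sum_shareUpdate]
    nlinarith [removed_nonneg hη hg hw0]
  unfold moved
  rw [Finset.mul_sum]
  refine Finset.sum_le_sum fun i _ => max_le ?_ ?_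
  · have := hw0 i; have := hg i; positivity
  have h1 : w i * Real.exp (-η * g i) / ∑ j, w j
      ≤ shareUpdate η α g w i / ∑ j, shareUpdate η α g w j :=
    div_le_div₀ (shareUpdate_pos hη hα hg hw i).le (mul_exp_le_shareUpdate hη hα hg hw0 i) hW' hle
  have h2 : 1 - η * g i ≤ Real.exp (-η * g i) := by
    have := Real.add_one_le_exp (-η * g i); linarith
  have h3 : w i / (∑ j, w j) * (1 - η * g i) ≤ w i * Real.exp (-η * g i) / ∑ j, w j := by
    rw [mul_div_right_comm]
    exact mul_le_mul_of_nonneg_left h2 (by have := hw0 i; positivity)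
  linarith

/-- Each update multiplies the total weight by at most `1 - (1 - α) (1 - exp (-η)) ⟨x_t, G t⟩`; then
`log y ≤ y - 1`. -/
theorem log_shareSeq_le (hη : 0 ≤ η) (hα : 0 ≤ α) (hα1 : α ≤ 1) (hG : ∀ t i, 0 ≤ G t i)
    (h0 : ∀ i, 0 < u 0 i) (hu : ∀ t, u (t + 1) = shareUpdate η α (G t) (u t)) {T : ℕ}
    (hG1 : ∀ t ≤ T, ∀ i, G t i ≤ 1) :
    Real.log (∑ i, u (T + 1) i) ≤ Real.log (∑ i, u 1 i) -
      (1 - α) * (1 - Real.exp (-η)) *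
        ∑ t ∈ Finset.Icc 1 T, ∑ i, u t i / (∑ j, u t j) * G t i := by
  induction T with
  | zero => simp
  | succ T ih =>
    rw [Finset.sum_Icc_succ_top (by omega)]
    have ih := ih fun t ht => hG1 t (ht.trans T.le_succ)
    set t := T + 1
    have hpos := shareSeq_pos hη hα hG h0 hu t
    have hpos' := shareSeq_pos hη hα hG h0 hu (t + 1)
    have hW : 0 < ∑ j, u t j := Finset.sum_pos (fun i _ => hpos i) Finset.univ_nonempty
    have hW' : 0 < ∑ j, u (t + 1) j := Finset.sum_pos (fun i _ => hpos' i) Finset.univ_nonempty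
    have h1 : ∑ i, u t i / (∑ j, u t j) * G t i = (∑ i, u t i * G t i) / ∑ j, u t j := by
      rw [Finset.sum_div]
      exact Finset.sum_congr rfl fun i _ => by ring
    have h2 : (∑ j, u (t + 1) j) / ∑ j, u t j
        ≤ 1 - (1 - α) * (1 - Real.exp (-η)) * ((∑ i, u t i * G t i) / ∑ j, u t j) := by
      rw [div_le_iff₀ hW, hu, sum_shareUpdate]
      have := removed_ge (η := η) (hG t) (hG1 t le_rfl) fun i => (hpos i).le
      have h3 : (1 - (1 - α) * (1 - Real.exp (-η)) * ((∑ i, u t i * G t i) / ∑ j, u t j)) *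
          ∑ j, u t j = ∑ j, u t j -
            (1 - α) * ((1 - Real.exp (-η)) * ∑ i, u t i * G t i) := by
        field_simp
      rw [h3]
      nlinarith [sub_nonneg.2 hα1]
    have h4 := Real.log_le_sub_one_of_pos (div_pos hW' hW)
    rw [Real.log_div hW'.ne' hW.ne'] at h4
    rw [mul_add, h1]
    linarith

/-- If, in a segment in which the comparator is `j` and loses `L`, the weight of `j` is at least
`2 c exp (-η L) (S - W)`, then the total weight `W` is at least `c exp (-η L) S`. -/
theorem total_ge_of_weight_ge {c E S W v : ℝ} (hc : 0 ≤ c) (hc1 : 2 * c ≤ 1) (hE1 : E ≤ 1) (hW : 0 ≤ W) (hv : 2 * c * E * (S - W) ≤ v) (hvW : v ≤ W) : c * E * S ≤ W := by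
  have : 2 * c * E ≤ 1 := by nlinarith
  nlinarith

/-- Invariant along the segments on which the comparator is constant: `S` is the total weight when
the current segment began and `Λ` the comparator's loss before it. When weight `R` is removed, the
total falls by `(1 - α) R ≤ R` and every heuristic receives `α R / ℓ`. So the comparator's weight is
at least `α / ℓ` times the drop of the total within the segment, discounted by its own loss there.
-/
theorem shareSeq_ge (hη : 0 ≤ η) (hα : 0 < α) (hα1 : α ≤ 1) (hG : ∀ t i, 0 ≤ G t i)
    (h0 : ∀ i, 0 < u 0 i) (hu : ∀ t, u (t + 1) = shareUpdate η α (G t) (u t))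
    (a : ℕ → Fin ℓ) (T : ℕ) :
    ∃ S Λ : ℝ, 0 ≤ Λ ∧ Λ ≤ ∑ t ∈ Finset.Icc 1 T, G t (a t) ∧
      (α / (2 * ℓ)) ^ switches (T + 1) a * Real.exp (-η * Λ) * ∑ i, u 1 i ≤ S ∧
      2 * (α / (2 * ℓ)) * Real.exp (-η * (∑ t ∈ Finset.Icc 1 T, G t (a t) - Λ)) *
        (S - ∑ i, u (T + 1) i) ≤ u (T + 1) (a (T + 1)) := by
  have hℓ : (1 : ℝ) ≤ ℓ := Nat.one_le_cast.2 (NeZero.pos ℓ)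
  set c : ℝ := α / (2 * ℓ) with hc
  have hc0 : 0 ≤ c := by positivity
  have hc1 : 2 * c ≤ 1 := by
    rw [hc, mul_div_assoc', div_le_one (by positivity)]; nlinarith
  induction T with
  | zero =>
    refine ⟨∑ i, u 1 i, 0, le_rfl, by simp, ?_, ?_⟩
    · simp [switches]
    · simpa using (shareSeq_pos hη hα.le hG h0 hu 1 (a 1)).le
  | succ T ih =>
    obtain ⟨S, Λ, hΛ0, hΛ, hS, hw⟩ := ih
    rw [Finset.sum_Icc_succ_top (by omega)]
    set L := ∑ t ∈ Finset.Icc 1 T, G t (a t)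
    set t := T + 1 with ht
    set j := a t with hj
    have hpos := shareSeq_pos hη hα.le hG h0 hu t
    have hpos' := shareSeq_pos hη hα.le hG h0 hu (t + 1)
    have hR := removed_nonneg hη (hG t) fun i => (hpos i).le
    have hW1 : ∑ i, u (t + 1) i = ∑ i, u t i - (1 - α) * removed η (G t) (u t) := by
      rw [hu, sum_shareUpdate]
    have hj1 : u (t + 1) j = u t j * Real.exp (-η * G t j) + 2 * c * removed η (G t) (u t) := by
      rw [hu]
      simp only [shareUpdate, removed, hc]
      field_simp
    have hE : Real.exp (-η * (L + G t j - Λ)) = Real.exp (-η * (L - Λ)) * Real.exp (-η * G t j) := by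
      rw [← Real.exp_add]; ring_nf
    have hE1 : Real.exp (-η * (L + G t j - Λ)) ≤ 1 :=
      Real.exp_le_one_iff.2 (by nlinarith [hG t j])
    have hE0 := Real.exp_pos (-η * (L + G t j - Λ))
    have hstep : 2 * c * Real.exp (-η * (L + G t j - Λ)) * (S - ∑ i, u (t + 1) i)
        ≤ u (t + 1) j := by
      have h1 := mul_le_mul_of_nonneg_right hw (Real.exp_pos (-η * G t j)).le
      have h2 : 2 * c * Real.exp (-η * (L + G t j - Λ)) * (S - ∑ i, u t i)
          ≤ u t j * Real.exp (-η * G t j) := by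
        rw [hE]; linarith
      have h3 : 2 * c * Real.exp (-η * (L + G t j - Λ)) * ((1 - α) * removed η (G t) (u t))
          ≤ 2 * c * removed η (G t) (u t) := by
        have h4 : (1 - α) * removed η (G t) (u t) ≤ removed η (G t) (u t) := by nlinarith
        have h5 : 0 ≤ (1 - α) * removed η (G t) (u t) := mul_nonneg (by linarith) hR
        calc _ ≤ 2 * c * 1 * ((1 - α) * removed η (G t) (u t)) := by gcongr
          _ ≤ 2 * c * 1 * removed η (G t) (u t) := by gcongr
          _ = _ := by ring
      rw [hW1, hj1]
      linarith
    by_cases hsw : a (T + 1) = a (T + 2)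
    · refine ⟨S, Λ, hΛ0, by linarith [hG t j], ?_, ?_⟩
      · rw [switches_succ_of_eq T a hsw]; exact hS
      · have : a (t + 1) = j := hsw.symm
        rw [this]; exact hstep
    · have hL0 : 0 ≤ L := Finset.sum_nonneg fun s _ => hG s _
      -- A switch opens a new segment with reference weight the current total, so no drop has
      -- occurred yet. Closing the old segment costs one factor `c` by `total_ge_of_weight_ge`.
      refine ⟨∑ i, u (t + 1) i, L + G t j, by linarith [hG t j], le_rfl, ?_, ?_⟩
      · rw [switches_succ_of_ne T a hsw]
        have hW0 : 0 ≤ ∑ i, u (t + 1) i := Finset.sum_nonneg fun i _ => (hpos' i).le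
        have hle : u (t + 1) j ≤ ∑ i, u (t + 1) i :=
          Finset.single_le_sum (fun i _ => (hpos' i).le) (Finset.mem_univ j)
        refine le_trans ?_ (total_ge_of_weight_ge hc0 hc1 hE1 hW0 hstep hle)
        have h6 := mul_le_mul_of_nonneg_left hS (mul_nonneg hc0 hE0.le)
        refine le_trans (le_of_eq ?_) h6
        have h7 : Real.exp (-η * (L + G t j))
            = Real.exp (-η * (L + G t j - Λ)) * Real.exp (-η * Λ) := by
          rw [← Real.exp_add]; ring_nf
        rw [h7, pow_succ]; ring
      · simpa using (hpos' _).le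

/-- Upper and lower bounds on the logarithm of the final total weight are compared. The `+ 2` stands
for a possible switch at time `T + 1`, to which the invariant refers, and for closing the last
segment. -/
theorem shareSeq_regret (hη : 0 ≤ η) (hα : 0 < α) (hα1 : α ≤ 1) (hG : ∀ t i, 0 ≤ G t i)
    (h0 : ∀ i, 0 < u 0 i) (hu : ∀ t, u (t + 1) = shareUpdate η α (G t) (u t))
    (a : ℕ → Fin ℓ) {T : ℕ} (hG1 : ∀ t ≤ T, ∀ i, G t i ≤ 1) :
    (1 - α) * (1 - Real.exp (-η)) * ∑ t ∈ Finset.Icc 1 T, ∑ i, u t i / (∑ j, u t j) * G t i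
      ≤ η * ∑ t ∈ Finset.Icc 1 T, G t (a t) +
        (switches T a + 2) * Real.log (2 * ℓ / α) := by
  have hℓ : (1 : ℝ) ≤ ℓ := Nat.one_le_cast.2 (NeZero.pos ℓ)
  obtain ⟨S, Λ, hΛ0, hΛ, hS, hw⟩ := shareSeq_ge hη hα hα1 hG h0 hu a T
  have hup := log_shareSeq_le hη hα.le hα1 hG h0 hu hG1
  set c : ℝ := α / (2 * ℓ) with hc
  set L := ∑ t ∈ Finset.Icc 1 T, G t (a t)
  have hc0 : 0 < c := by positivity
  have hc1 : 2 * c ≤ 1 := by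
    rw [hc, mul_div_assoc', div_le_one (by positivity)]; nlinarith
  have hpos := shareSeq_pos hη hα.le hG h0 hu (T + 1)
  have hpos1 := shareSeq_pos hη hα.le hG h0 hu 1
  have hW1 : 0 < ∑ j, u 1 j := Finset.sum_pos (fun i _ => hpos1 i) Finset.univ_nonempty
  have hW0 : 0 ≤ ∑ i, u (T + 1) i := Finset.sum_nonneg fun i _ => (hpos i).le
  have hle : u (T + 1) (a (T + 1)) ≤ ∑ i, u (T + 1) i :=
    Finset.single_le_sum (fun i _ => (hpos i).le) (Finset.mem_univ _)
  have h1 := total_ge_of_weight_ge hc0.le hc1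
    (Real.exp_le_one_iff.2 (by nlinarith)) hW0 hw hle
  have h2 : c ^ (switches (T + 1) a + 1) * Real.exp (-η * L) * ∑ i, u 1 i
      ≤ ∑ i, u (T + 1) i := by
    refine le_trans ?_ h1
    have h6 := mul_le_mul_of_nonneg_left hS
      (mul_nonneg hc0.le (Real.exp_pos (-η * (L - Λ))).le)
    refine le_trans (le_of_eq ?_) h6
    have h7 : Real.exp (-η * L) = Real.exp (-η * (L - Λ)) * Real.exp (-η * Λ) := by
      rw [← Real.exp_add]; ring_nf
    rw [h7, pow_succ]; ring
  have h3 := Real.log_le_log (by positivity) h2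
  rw [Real.log_mul (by positivity) hW1.ne', Real.log_mul (by positivity) (Real.exp_pos _).ne',
    Real.log_exp, Real.log_pow] at h3
  have h4 : Real.log c = -Real.log (2 * ℓ / α) := by
    rw [← Real.log_inv, inv_div]
  have h5 : 0 ≤ Real.log (2 * ℓ / α) :=
    Real.log_nonneg ((one_le_div hα).2 (by linarith))
  have h6 : ((switches (T + 1) a + 1 : ℕ) : ℝ) ≤ switches T a + 2 := by
    have := switches_succ_le T a
    exact_mod_cast (by omega)
  rw [h4] at h3
  nlinarith [mul_le_mul_of_nonneg_right h6 h5]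

end Share

section

/-! ### The learning dynamics for fixed coins and explored heuristics -/

section Countdown

variable {m : ℕ} {b : ℕ → Bool}

theorem exists_trigger {t : ℕ} (h : countdown m b t ≠ 0) :
    ∃ r < t, countdown m b r = 0 ∧ b r = true ∧ r + (m + 1) = t + countdown m b t := by
  induction t with
  | zero => exact absurd rfl h
  | succ t ih =>
    simp only [countdown] at h ⊢
    by_cases h0 : countdown m b t = 0
    · by_cases hb : b t = true
      · exact ⟨t, t.lt_succ_self, h0, hb, by simp [h0, hb]; omega⟩
      · simp [h0, hb] at h
    · obtain ⟨r, hr, h1, h2, h3⟩ := ih h0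
      refine ⟨r, by omega, h1, h2, ?_⟩
      simp only [h0, if_false] at h ⊢
      omega

theorem countdown_le (t : ℕ) : countdown m b t ≤ m := by
  by_cases h : countdown m b t = 0
  · omega
  · obtain ⟨r, hr, -, -, h3⟩ := exists_trigger h
    omega

theorem exists_coin {t : ℕ} (h : countdown m b t ≠ 0) : ∃ r ∈ Finset.Ico (t - m) t, b r = true := by
  obtain ⟨r, hr, -, h2, h3⟩ := exists_trigger h
  have := countdown_le (m := m) (b := b) t
  exact ⟨r, Finset.mem_Ico.2 ⟨by omega, hr⟩, h2⟩

theorem coin_of_countdown_eq_one {t : ℕ} (h : countdown m b t = 1) : b (t - m) = true := by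
  obtain ⟨r, hr, -, h2, h3⟩ := exists_trigger (t := t) (m := m) (b := b) (by omega)
  rwa [show t - m = r by omega]

theorem countdown_of_trigger {r j : ℕ} (h : countdown m b r = 0) (hb : b r = true) (hj : j < m) :
    countdown m b (r + j + 1) = m - j := by
  induction j with
  | zero => simp [countdown, h, hb]
  | succ j ih =>
    have ih := ih (by omega)
    rw [← Nat.add_assoc, countdown, ih, if_neg (by omega)]
    omega

/-- The schedule up to time `t` depends only on coins before `t`. This is the source of every later
independence of the coin at time `t`. -/
theorem countdown_update {t r : ℕ} (h : t ≤ r) (c : Bool) :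
    countdown m (Function.update b r c) t = countdown m b t := by
  induction t with
  | zero => rfl
  | succ t ih =>
    rw [countdown, countdown, ih (by omega), Function.update_of_ne (by omega)]

end Countdown

variable {M : Type*} [MetricSpace M] {ℓ : ℕ}

section Dynamics

variable (I : Input M ℓ) {m : ℕ} {η α : ℝ} {b : ℕ → Bool} {e : ℕ → Fin ℓ}

/-- The cost of heuristic `i` at time `t` as a real number. -/
def Input.hcost (t : ℕ) (i : Fin ℓ) : ℝ := (I.heuristicCost t i).toReal

theorem Input.hcost_nonneg (t : ℕ) (i : Fin ℓ) : 0 ≤ I.hcost t i := ENNReal.toReal_nonneg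

theorem Input.heuristicCost_le {t : ℕ} (ht : t ∈ Finset.Icc 1 I.T) (i : Fin ℓ) :
    I.heuristicCost t i ≤ ENNReal.ofReal (2 * diameter M) := by
  rw [Finset.mem_Icc] at ht
  obtain ⟨s, rfl⟩ : ∃ s, t = s + 1 := ⟨t - 1, by omega⟩
  exact I.step_le s (by omega) i

theorem Input.ofReal_hcost {t : ℕ} (ht : t ∈ Finset.Icc 1 I.T) (i : Fin ℓ) :
    ENNReal.ofReal (I.hcost t i) = I.heuristicCost t i :=
  ENNReal.ofReal_toReal (ne_top_of_le_ne_top ENNReal.ofReal_ne_top (I.heuristicCost_le ht i))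

theorem Input.hcost_le (hD : 1 ≤ diameter M) {t : ℕ} (ht : t ∈ Finset.Icc 1 I.T) (i : Fin ℓ) :
    I.hcost t i ≤ 2 * diameter M :=
  ENNReal.toReal_le_of_le_ofReal (by linarith) (I.heuristicCost_le ht i)

/-- The loss vector of step `t`; it vanishes unless `t` is an exploration step. -/
def Input.loss (m : ℕ) (b : ℕ → Bool) (e : ℕ → Fin ℓ) (t : ℕ) : Fin ℓ → ℝ :=
  if countdown m b t = 1 then I.feedback e t else fun _ => 0

theorem Input.weights_succ (t : ℕ) : I.weights m η α b e (t + 1)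
    = shareUpdate η α (I.loss m b e t) (I.weights m η α b e t) := by
  rw [weights, loss]
  split_ifs
  · rfl
  · rw [shareUpdate_zero]

theorem Input.loss_apply (t : ℕ) (i : Fin ℓ) : I.loss m b e t i
    = if countdown m b t = 1 then (if i = e t then I.hcost t i / (2 * diameter M) else 0)
      else 0 := by
  unfold loss
  by_cases h : countdown m b t = 1
  · rw [if_pos h, if_pos h, feedback, hcost]
    by_cases hi : i = e t
    · rw [if_pos hi, if_pos hi, hi]
    · rw [if_neg hi, if_neg hi]
  · rw [if_neg h, if_neg h]

theorem Input.loss_nonneg (hD : 1 ≤ diameter M) (t : ℕ) (i : Fin ℓ) :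
    0 ≤ I.loss m b e t i := by
  rw [loss_apply]
  have := I.hcost_nonneg t i
  split_ifs <;> positivity

theorem Input.loss_le_one (hD : 1 ≤ diameter M) {t : ℕ} (ht : t ≤ I.T) (i : Fin ℓ) :
    I.loss m b e t i ≤ 1 := by
  rw [loss_apply]
  split_ifs with h1 h2
  · rw [div_le_one (by linarith)]
    refine I.hcost_le hD (Finset.mem_Icc.2 ⟨?_, ht⟩) i
    rcases t with _ | t
    · simp [countdown] at h1
    · omega
  · exact zero_le_one
  · exact zero_le_one

theorem Input.weights_update_coin {t r : ℕ} (h : t ≤ r) (c : Bool) :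
    I.weights m η α (Function.update b r c) e t = I.weights m η α b e t := by
  induction t with
  | zero => rfl
  | succ t ih => rw [weights, weights, ih (by omega), countdown_update (by omega)]

theorem Input.weights_update_explored {t r : ℕ} (h : t ≤ r) (i : Fin ℓ) :
    I.weights m η α b (Function.update e r i) t = I.weights m η α b e t := by
  induction t with
  | zero => rfl
  | succ t ih =>
    have : I.feedback (Function.update e r i) t = I.feedback e t := by
      funext j
      simp only [feedback, Function.update_of_ne (show t ≠ r by omega)]
    rw [weights, weights, ih (by omega), this]

theorem Input.fractional_update_coin {t r : ℕ} (h : t ≤ r) (c : Bool) :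
    I.fractional m η α (Function.update b r c) e t = I.fractional m η α b e t := by
  unfold fractional; rw [I.weights_update_coin h]

theorem Input.fractional_update_explored {t r : ℕ} (h : t ≤ r) (i : Fin ℓ) :
    I.fractional m η α b (Function.update e r i) t = I.fractional m η α b e t := by
  unfold fractional; rw [I.weights_update_explored h]

/-- Within a block the weights change only after its last step, so the exploration step still sees
the weights of the triggering step. -/
theorem Input.weights_of_trigger {r : ℕ} (h : countdown m b r = 0) (hb : b r = true) {j : ℕ}
    (hj : j ≤ m) : I.weights m η α b e (r + j) = I.weights m η α b e r := by
  induction j with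
  | zero => rfl
  | succ j ih =>
    rw [← Nat.add_assoc, weights, if_neg, ih (by omega)]
    rcases j with _ | j
    · simp [h]
    · rw [← Nat.add_assoc, countdown_of_trigger h hb (by omega)]
      omega

theorem Input.fractional_of_trigger {r : ℕ} (h : countdown m b r = 0) (hb : b r = true) :
    I.fractional m η α b e (r + m) = I.fractional m η α b e r := by
  unfold fractional; rw [I.weights_of_trigger h hb le_rfl]

theorem countdown_add_of_trigger (hm : 1 ≤ m) {r : ℕ} (h : countdown m b r = 0)
    (hb : b r = true) : countdown m b (r + m) = 1 := by
  obtain ⟨j, rfl⟩ : ∃ j, m = j + 1 := ⟨m - 1, by omega⟩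
  rw [← Nat.add_assoc, countdown_of_trigger h hb (by omega)]
  omega

theorem Input.weights_pos (hD : 1 ≤ diameter M) (hη : 0 ≤ η) (hα : 0 ≤ α) (t : ℕ) (i : Fin ℓ) :
    0 < I.weights m η α b e t i :=
  shareSeq_pos (G := I.loss m b e) hη hα (I.loss_nonneg hD) (by simp [weights])
    (fun t => I.weights_succ t) t i

variable [NeZero ℓ]

theorem Input.sum_weights_pos (hD : 1 ≤ diameter M) (hη : 0 ≤ η) (hα : 0 ≤ α) (t : ℕ) :
    0 < ∑ i, I.weights m η α b e t i :=
  Finset.sum_pos (fun i _ => I.weights_pos hD hη hα t i) Finset.univ_nonempty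

theorem Input.fractional_pos (hD : 1 ≤ diameter M) (hη : 0 ≤ η) (hα : 0 ≤ α) (t : ℕ)
    (i : Fin ℓ) : 0 < I.fractional m η α b e t i :=
  div_pos (I.weights_pos hD hη hα t i) (I.sum_weights_pos hD hη hα t)

theorem Input.sum_fractional (hD : 1 ≤ diameter M) (hη : 0 ≤ η) (hα : 0 ≤ α) (t : ℕ) :
    ∑ i, I.fractional m η α b e t i = 1 := by
  unfold fractional
  rw [← Finset.sum_div, div_self (I.sum_weights_pos hD hη hα t).ne']

theorem Input.moved_fractional_le (hD : 1 ≤ diameter M) (hη : 0 ≤ η) (hα : 0 ≤ α) (hα1 : α ≤ 1)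
    (t : ℕ) : moved (I.fractional m η α b e t) (I.fractional m η α b e (t + 1))
      ≤ η * ∑ i, I.fractional m η α b e t i * I.loss m b e t i := by
  unfold fractional
  rw [I.weights_succ]
  exact moved_shareUpdate_le hη hα hα1 (I.loss_nonneg hD t) fun i => I.weights_pos hD hη hα t i

theorem Input.regret (hD : 1 ≤ diameter M) (hη : 0 ≤ η) (hα : 0 < α) (hα1 : α ≤ 1)
    (a : ℕ → Fin ℓ) :
    (1 - α) * (1 - Real.exp (-η)) *
        ∑ t ∈ Finset.Icc 1 I.T, ∑ i, I.fractional m η α b e t i * I.loss m b e t i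
      ≤ η * ∑ t ∈ Finset.Icc 1 I.T, I.loss m b e t (a t) +
        (switches I.T a + 2) * Real.log (2 * ℓ / α) :=
  shareSeq_regret hη hα hα1 (I.loss_nonneg hD) (by simp [weights])
    (fun t => I.weights_succ t) a fun _ ht => I.loss_le_one hD ht

end Dynamics

end

/-! ### Expectations over the coins and the explored heuristics -/

section Expectation

variable {ℓ T n : ℕ} {ρ : ℝ}

theorem fromOne_update {A : Type*} [Inhabited A] {n : ℕ} (v : Fin n → A) (r : Fin n) (c : A) :
    fromOne (Function.update v r c) = Function.update (fromOne v) (r + 1) c := by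
  funext t
  rcases t with _ | t
  · simp [fromOne, Function.update]
  · by_cases h : t = r
    · subst h
      simp [fromOne, fromZero]
    · rw [Function.update_of_ne (by omega)]
      simp only [fromOne, fromZero]
      split_ifs with ht
      · rw [Function.update_of_ne (fun hr => h (congrArg Fin.val hr))]
      · rfl

/-- The probability of an outcome of the coins and of the explored heuristics. -/
def coinWeight (ρ : ℝ) (β : Fin T → Bool) (_e : Fin n → Fin ℓ) : ℝ :=
  (∏ t, if β t then ρ else 1 - ρ) * ∏ _t : Fin n, (1 / ℓ : ℝ)

theorem coinWeight_nonneg (h0 : 0 ≤ ρ) (h1 : ρ ≤ 1) (β : Fin T → Bool) (e : Fin n → Fin ℓ) :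
    0 ≤ coinWeight ρ β e := by
  refine mul_nonneg (Finset.prod_nonneg fun t _ => ?_) (Finset.prod_nonneg fun t _ => ?_)
  · split_ifs <;> linarith
  · positivity

variable [NeZero ℓ]

/-- The expectation of a function of the coins at times `1, …, T` and of the explored heuristics
at times `1, …, n`. -/
def coinExp (T n : ℕ) (ρ : ℝ) (G : (ℕ → Bool) → (ℕ → Fin ℓ) → ℝ) : ℝ :=
  ∑ β : Fin T → Bool, ∑ e : Fin n → Fin ℓ, coinWeight ρ β e * G (fromOne β) (fromOne e)

variable {G H : (ℕ → Bool) → (ℕ → Fin ℓ) → ℝ}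

theorem coinExp_mono (h0 : 0 ≤ ρ) (h1 : ρ ≤ 1) (h : ∀ b e, G b e ≤ H b e) :
    coinExp T n ρ G ≤ coinExp T n ρ H :=
  Finset.sum_le_sum fun _ _ => Finset.sum_le_sum fun _ _ =>
    mul_le_mul_of_nonneg_left (h _ _) (coinWeight_nonneg h0 h1 _ _)

theorem coinExp_add : coinExp T n ρ (fun b e => G b e + H b e)
    = coinExp T n ρ G + coinExp T n ρ H := by
  simp only [coinExp, mul_add, Finset.sum_add_distrib]

theorem coinExp_mul (c : ℝ) : coinExp T n ρ (fun b e => c * G b e) = c * coinExp T n ρ G := by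
  simp only [coinExp, Finset.mul_sum, mul_left_comm]

theorem coinExp_sum {ι : Type*} (s : Finset ι) (K : ι → (ℕ → Bool) → (ℕ → Fin ℓ) → ℝ) :
    coinExp T n ρ (fun b e => ∑ i ∈ s, K i b e) = ∑ i ∈ s, coinExp T n ρ (K i) := by
  simp only [coinExp, Finset.mul_sum]
  rw [Finset.sum_comm]
  conv_rhs => rw [Finset.sum_comm]
  rw [Finset.sum_comm]
  refine Finset.sum_congr rfl fun β _ => ?_
  rw [Finset.sum_comm]

theorem coinExp_eq_sum_coins : coinExp T n ρ G = ∑ β : Fin T → Bool,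
    (∏ t, if β t then ρ else 1 - ρ) *
      ∑ e : Fin n → Fin ℓ, (∏ _t : Fin n, (1 / ℓ : ℝ)) * G (fromOne β) (fromOne e) := by
  simp only [coinExp, coinWeight, mul_assoc, Finset.mul_sum]

theorem coinExp_eq_sum_explored : coinExp T n ρ G = ∑ e : Fin n → Fin ℓ,
    (∏ _t : Fin n, (1 / ℓ : ℝ)) *
      ∑ β : Fin T → Bool, (∏ t, if β t then ρ else 1 - ρ) * G (fromOne β) (fromOne e) := by
  rw [coinExp, Finset.sum_comm]
  refine Finset.sum_congr rfl fun e _ => ?_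
  rw [Finset.mul_sum]
  exact Finset.sum_congr rfl fun β _ => by rw [coinWeight]; ring

theorem coinExp_const (c : ℝ) : coinExp (ℓ := ℓ) T n ρ (fun _ _ => c) = c := by
  have hℓ : (ℓ : ℝ) ≠ 0 := Nat.cast_ne_zero.2 (NeZero.ne ℓ)
  have h1 := sum_prod_eq_one (ι := Fin T) (fun _ (a : Bool) => if a then ρ else 1 - ρ)
    (by simp)
  have h2 := sum_prod_eq_one (ι := Fin n) (fun _ (_ : Fin ℓ) => (1 / ℓ : ℝ))
    (by simp [hℓ])
  rw [coinExp_eq_sum_coins]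
  simp only [← Finset.sum_mul, h1, h2, one_mul]

theorem coinExp_nonneg (h0 : 0 ≤ ρ) (h1 : ρ ≤ 1) (h : ∀ b e, 0 ≤ G b e) :
    0 ≤ coinExp T n ρ G := by
  rw [← coinExp_const (ℓ := ℓ) (T := T) (n := n) (ρ := ρ) 0]
  exact coinExp_mono h0 h1 h

/-- A coin is independent of a function of the other random choices. -/
theorem coinExp_coin {r : ℕ} (hr : r ∈ Finset.Icc 1 T)
    (hG : ∀ b e c, G (Function.update b r c) e = G b e) :
    coinExp T n ρ (fun b e => if b r then G b e else 0) = ρ * coinExp T n ρ G := by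
  rw [Finset.mem_Icc] at hr
  set i : Fin T := ⟨r - 1, by omega⟩
  have hi : (i : ℕ) + 1 = r := by simp only [i]; omega
  have key : ∀ e : Fin n → Fin ℓ, ∑ β : Fin T → Bool, (∏ t, if β t then ρ else 1 - ρ) *
      (if fromOne β r then G (fromOne β) (fromOne e) else 0)
      = ∑ β : Fin T → Bool, (∏ t, if β t then ρ else 1 - ρ) *
          (ρ * G (fromOne β) (fromOne e)) := fun e => by
    rw [sum_prod_resample (fun _ (a : Bool) => if a then ρ else 1 - ρ) i (by simp)]
    refine Finset.sum_congr rfl fun β _ => ?_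
    simp [fromOne_update, hi, hG]
  rw [coinExp_eq_sum_explored, ← coinExp_mul, coinExp_eq_sum_explored]
  exact Finset.sum_congr rfl fun e _ => congrArg _ (key e)

theorem coinExp_coin_le (h0 : 0 ≤ ρ) (h1 : ρ ≤ 1) (r : ℕ) (hG0 : ∀ b e, 0 ≤ G b e)
    (hG : ∀ b e c, G (Function.update b r c) e = G b e) :
    coinExp T n ρ (fun b e => if b r then G b e else 0) ≤ ρ * coinExp T n ρ G := by
  by_cases hr : r ∈ Finset.Icc 1 T
  · exact (coinExp_coin hr hG).le
  -- Outside the range of the coins `fromOne` takes its default value `false`, so such a coin never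
  -- fires.
  · have hb : ∀ β : Fin T → Bool, fromOne β r = false := fun β => by
      rw [Finset.mem_Icc] at hr
      rcases r with _ | r
      · rfl
      · simp only [fromOne, fromZero]
        rw [dif_neg (by omega)]
        rfl
    have : coinExp T n ρ (fun b e => if b r then G b e else 0) = 0 := by
      simp [coinExp, hb]
    rw [this]
    exact mul_nonneg h0 (coinExp_nonneg h0 h1 hG0)

/-- An explored heuristic is uniform and independent of the other random choices. -/
theorem coinExp_explored {r : ℕ} (hr : r ∈ Finset.Icc 1 n)
    {K : (ℕ → Bool) → (ℕ → Fin ℓ) → Fin ℓ → ℝ}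
    (hK : ∀ b e c, K b (Function.update e r c) = K b e) :
    coinExp T n ρ (fun b e => K b e (e r)) = 1 / ℓ * coinExp T n ρ (fun b e => ∑ i, K b e i) := by
  rw [Finset.mem_Icc] at hr
  have hℓ : (ℓ : ℝ) ≠ 0 := Nat.cast_ne_zero.2 (NeZero.ne ℓ)
  set i : Fin n := ⟨r - 1, by omega⟩
  have hi : (i : ℕ) + 1 = r := by simp only [i]; omega
  have key : ∀ β : Fin T → Bool, ∑ e : Fin n → Fin ℓ, (∏ _t : Fin n, (1 / ℓ : ℝ)) *
      K (fromOne β) (fromOne e) (fromOne e r)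
      = ∑ e : Fin n → Fin ℓ, (∏ _t : Fin n, (1 / ℓ : ℝ)) *
          (1 / ℓ * ∑ j, K (fromOne β) (fromOne e) j) := fun β => by
    rw [sum_prod_resample (fun _ (_ : Fin ℓ) => (1 / ℓ : ℝ)) i (by simp [hℓ])]
    refine Finset.sum_congr rfl fun e _ => ?_
    simp only [fromOne_update, hi, hK, Function.update_self, Finset.mul_sum]
  rw [coinExp_eq_sum_coins, ← coinExp_mul, coinExp_eq_sum_coins]
  exact Finset.sum_congr rfl fun β _ => congrArg _ (key β)

end Expectation

section

/-! ### The expected cost of the fractional solution -/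

/-- Each `u` lies in at most `w` of the windows. -/
theorem sum_window_le {f : ℕ → ℝ} (hf : ∀ u, 0 ≤ f u) (T w : ℕ) :
    ∑ t ∈ Finset.Icc 1 T, ∑ u ∈ Finset.Ioc (t - w) t, f u ≤ w * ∑ u ∈ Finset.Icc 1 T, f u := by
  rw [Finset.sum_comm' (t' := Finset.Icc 1 T)
    (s' := fun u => (Finset.Icc 1 T).filter fun t => u ∈ Finset.Ioc (t - w) t)
    (fun t u => by simp only [Finset.mem_Icc, Finset.mem_Ioc, Finset.mem_filter]; omega),
    Finset.mul_sum]
  refine Finset.sum_le_sum fun u _ => ?_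
  rw [Finset.sum_const, nsmul_eq_mul]
  refine mul_le_mul_of_nonneg_right ?_ (hf u)
  have : (Finset.Icc 1 T).filter (fun t => u ∈ Finset.Ioc (t - w) t) ⊆ Finset.Ico u (u + w) := by
    intro t
    simp only [Finset.mem_Icc, Finset.mem_Ioc, Finset.mem_filter, Finset.mem_Ico]
    omega
  have := Finset.card_le_card this
  rw [Nat.card_Ico] at this
  exact_mod_cast this.trans (by omega)

open Classical in
/-- Indicator of the event that one of the last `2 m` coins triggers exploration. -/
def recentCoin (m : ℕ) (b : ℕ → Bool) (t : ℕ) : ℝ :=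
  if ∃ r ∈ Finset.Ico (t - 2 * m) t, b r = true then 1 else 0

theorem recentCoin_nonneg (m : ℕ) (b : ℕ → Bool) (t : ℕ) : 0 ≤ recentCoin m b t := by
  unfold recentCoin; split_ifs <;> norm_num

theorem recentCoin_le_one (m : ℕ) (b : ℕ → Bool) (t : ℕ) : recentCoin m b t ≤ 1 := by
  unfold recentCoin; split_ifs <;> norm_num

/-- The union bound, kept pointwise so that each coin can afterwards be averaged separately. -/
theorem ite_exists_coin_mul_le (s : Finset ℕ) (b : ℕ → Bool) {c : ℝ} (hc : 0 ≤ c) :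
    (if ∃ r ∈ s, b r = true then c else 0) ≤ ∑ r ∈ s, if b r then c else 0 := by
  have h0 : ∀ r ∈ s, 0 ≤ if b r then c else 0 := fun r _ => by split_ifs <;> simp [hc]
  split_ifs with h
  · obtain ⟨r, hr, hb⟩ := h
    exact le_trans (by simp [hb]) (Finset.single_le_sum h0 hr)
  · exact Finset.sum_nonneg h0

variable {M : Type*} [MetricSpace M] {ℓ : ℕ} (I : Input M ℓ) (m : ℕ) (η α : ℝ)

/-- The cost at time `t` of the fractional solution of time `s`. -/
def Input.staleCost (s t : ℕ) (b : ℕ → Bool) (e : ℕ → Fin ℓ) : ℝ :=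
  ∑ i, I.fractional m η α b e s i * I.hcost t i

/-- The mass moved by the fractional solution at time `u`. -/
def Input.movement (u : ℕ) (b : ℕ → Bool) (e : ℕ → Fin ℓ) : ℝ :=
  moved (I.fractional m η α b e (u - 1)) (I.fractional m η α b e u)

/-- The mass moved by the fractional solution at the last `2 m` times. -/
def Input.recentMovement (t : ℕ) (b : ℕ → Bool) (e : ℕ → Fin ℓ) : ℝ :=
  ∑ u ∈ Finset.Ioc (t - 2 * m) t, I.movement m η α u b e

/-- The cost of the fractional solution in the exploration steps. -/
def Input.exploreCost (t : ℕ) (b : ℕ → Bool) (e : ℕ → Fin ℓ) : ℝ :=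
  if countdown m b t = 1 then I.staleCost m η α t t b e else 0

variable {m η α}

theorem Input.movement_nonneg (u : ℕ) (b : ℕ → Bool) (e : ℕ → Fin ℓ) :
    0 ≤ I.movement m η α u b e := moved_nonneg _ _

theorem Input.recentMovement_nonneg (t : ℕ) (b : ℕ → Bool) (e : ℕ → Fin ℓ) :
    0 ≤ I.recentMovement m η α t b e := Finset.sum_nonneg fun u _ => I.movement_nonneg u b e

theorem Input.staleCost_update {s r : ℕ} (h : s ≤ r) (t : ℕ) (b : ℕ → Bool) (e : ℕ → Fin ℓ)
    (c : Bool) :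
    I.staleCost m η α s t (Function.update b r c) e = I.staleCost m η α s t b e := by
  unfold staleCost; rw [I.fractional_update_coin h]

theorem Input.movement_update {u r : ℕ} (h : u ≤ r) (b : ℕ → Bool) (e : ℕ → Fin ℓ)
    (c : Bool) : I.movement m η α u (Function.update b r c) e = I.movement m η α u b e := by
  unfold movement
  rw [I.fractional_update_coin h, I.fractional_update_coin (by omega)]

theorem Input.moved_le_recentMovement {s s' t : ℕ} (h1 : t - 2 * m ≤ s) (h2 : s ≤ s')
    (h3 : s' ≤ t) (b : ℕ → Bool) (e : ℕ → Fin ℓ) :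
    moved (I.fractional m η α b e s) (I.fractional m η α b e s')
      ≤ I.recentMovement m η α t b e :=
  (moved_le_sum (fun t => I.fractional m η α b e t) h2).trans
    (Finset.sum_le_sum_of_subset_of_nonneg (Finset.Ioc_subset_Ioc h1 h3)
      fun u _ _ => I.movement_nonneg u b e)

theorem Input.staleCost_le_later (hD : 1 ≤ diameter M) {t : ℕ} (ht : t ∈ Finset.Icc 1 I.T) {s s' : ℕ}
    (h1 : t - 2 * m ≤ s) (h2 : s ≤ s') (h3 : s' ≤ t) (b : ℕ → Bool) (e : ℕ → Fin ℓ) :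
    I.staleCost m η α s t b e
      ≤ I.staleCost m η α s' t b e + 2 * diameter M * I.recentMovement m η α t b e := by
  refine (sum_mul_le_add_moved (p' := I.fractional m η α b e s') (I.hcost_nonneg t)
    (I.hcost_le hD ht)).trans (add_le_add_right ?_ _)
  exact mul_le_mul_of_nonneg_left (I.moved_le_recentMovement h1 h2 h3 b e)
    (by linarith)

variable [NeZero ℓ]

section Pointwise

variable (hD : 1 ≤ diameter M) (hη : 0 ≤ η) (hα : 0 ≤ α)
include hD hη hα

theorem Input.staleCost_nonneg (s t : ℕ) (b : ℕ → Bool) (e : ℕ → Fin ℓ) :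
    0 ≤ I.staleCost m η α s t b e :=
  Finset.sum_nonneg fun i _ =>
    mul_nonneg (I.fractional_pos hD hη hα s i).le (I.hcost_nonneg t i)

theorem Input.staleCost_le {t : ℕ} (ht : t ∈ Finset.Icc 1 I.T) (s : ℕ) (b : ℕ → Bool)
    (e : ℕ → Fin ℓ) : I.staleCost m η α s t b e ≤ 2 * diameter M := by
  calc I.staleCost m η α s t b e
      ≤ ∑ i, I.fractional m η α b e s i * (2 * diameter M) :=
        Finset.sum_le_sum fun i _ =>
          mul_le_mul_of_nonneg_left (I.hcost_le hD ht i) (I.fractional_pos hD hη hα s i).le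
    _ = 2 * diameter M := by rw [← Finset.sum_mul, I.sum_fractional hD hη hα, one_mul]

theorem Input.staleCost_le_earlier {t : ℕ} (ht : t ∈ Finset.Icc 1 I.T) {s s' : ℕ}
    (h1 : t - 2 * m ≤ s) (h2 : s ≤ s') (h3 : s' ≤ t) (b : ℕ → Bool) (e : ℕ → Fin ℓ) :
    I.staleCost m η α s' t b e
      ≤ I.staleCost m η α s t b e + 2 * diameter M * I.recentMovement m η α t b e := by
  refine (sum_mul_le_add_moved (p' := I.fractional m η α b e s) (I.hcost_nonneg t)
    (I.hcost_le hD ht)).trans (add_le_add_right ?_ _)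
  rw [moved_comm (by rw [I.sum_fractional hD hη hα, I.sum_fractional hD hη hα])]
  exact mul_le_mul_of_nonneg_left (I.moved_le_recentMovement h1 h2 h3 b e)
    (by linarith)

theorem Input.exploreCost_nonneg (t : ℕ) (b : ℕ → Bool) (e : ℕ → Fin ℓ) :
    0 ≤ I.exploreCost m η α t b e := by
  unfold exploreCost
  split_ifs
  · exact I.staleCost_nonneg hD hη hα t t b e
  · exact le_rfl

end Pointwise

/-- Neither `x_t` nor the schedule depends on `e t`, so averaging over the explored heuristic turns
the single observed cost into `1 / ℓ` times the full inner product. -/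
theorem Input.coinExp_loss_eq {n : ℕ} {ρ : ℝ} (hD : 1 ≤ diameter M) {t : ℕ} (ht : t ∈ Finset.Icc 1 n) :
    coinExp I.T n ρ (fun b e => ∑ i, I.fractional m η α b e t i * I.loss m b e t i)
      = 1 / (2 * diameter M * ℓ) * coinExp I.T n ρ (I.exploreCost m η α t) := by
  have hD0 : diameter M ≠ 0 := by linarith
  have h2 : ∀ b e, ∑ i, I.fractional m η α b e t i * I.loss m b e t i
      = if countdown m b t = 1 then
          I.fractional m η α b e t (e t) * (I.hcost t (e t) / (2 * diameter M)) else 0 :=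
    fun b e => by
      simp only [loss_apply]
      split_ifs <;> simp
  simp only [h2]
  rw [coinExp_explored ht (K := fun b e i => if countdown m b t = 1 then
      I.fractional m η α b e t i * (I.hcost t i / (2 * diameter M)) else 0)
      (fun b e c => by funext i; rw [I.fractional_update_explored le_rfl])]
  rw [← coinExp_mul, ← coinExp_mul]
  congr 1
  funext b e
  unfold exploreCost staleCost
  by_cases hc : countdown m b t = 1
  · simp only [if_pos hc, Finset.mul_sum]
    refine Finset.sum_congr rfl fun i _ => ?_
    field_simp
  · simp [hc]

theorem Input.sum_coinExp_recentMovement_le {n : ℕ} {ρ : ℝ} (h0 : 0 ≤ ρ) (h1 : ρ ≤ 1) :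
    ∑ t ∈ Finset.Icc 1 I.T, coinExp I.T n ρ (I.recentMovement m η α t)
      ≤ 2 * m * ∑ u ∈ Finset.Icc 1 I.T, coinExp I.T n ρ (I.movement m η α u) := by
  unfold recentMovement
  simp only [coinExp_sum]
  exact_mod_cast sum_window_le (fun u => coinExp_nonneg h0 h1 (I.movement_nonneg u)) I.T (2 * m)

/-- The factor `ρ` arises because an exploration step at `t` forces the coin at `t - m` to fire;
only this upper bound is needed for the comparator. -/
theorem Input.coinExp_loss_comparator_le {n : ℕ} {ρ : ℝ} (hD : 1 ≤ diameter M) (h0 : 0 ≤ ρ)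
    (h1 : ρ ≤ 1) {t : ℕ} (ht : t ∈ Finset.Icc 1 n) (j : Fin ℓ) :
    coinExp I.T n ρ (fun b e => I.loss m b e t j)
      ≤ 1 / (2 * diameter M * ℓ) * (ρ * I.hcost t j) := by
  have hD0 : diameter M ≠ 0 := by linarith
  have hF := I.hcost_nonneg t j
  have h2 : ∀ b e, I.loss m b e t j = if countdown m b t = 1 then
      (if j = e t then I.hcost t j / (2 * diameter M) else 0) else 0 :=
    fun b e => I.loss_apply t j
  simp only [h2]
  rw [coinExp_explored ht (K := fun b e i => if countdown m b t = 1 then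
      (if j = i then I.hcost t j / (2 * diameter M) else 0) else 0) (fun b e c => rfl)]
  have h3 : coinExp (ℓ := ℓ) I.T n ρ (fun b e => ∑ i, if countdown m b t = 1 then
      (if j = i then I.hcost t j / (2 * diameter M) else 0) else 0)
      ≤ ρ * (I.hcost t j / (2 * diameter M)) := by
    have hF' : 0 ≤ I.hcost t j / (2 * diameter M) := by positivity
    rw [← coinExp_const (ℓ := ℓ) (T := I.T) (n := n) (ρ := ρ) (I.hcost t j / (2 * diameter M))]
    refine le_trans (coinExp_mono h0 h1 fun b e => ?_)
      (coinExp_coin_le h0 h1 (t - m) (fun _ _ => hF') fun _ _ _ => rfl)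
    rw [coinExp_const]
    by_cases hc : countdown m b t = 1
    · simp [hc, coin_of_countdown_eq_one hc]
    · simp only [hc, if_false, Finset.sum_const_zero]
      split_ifs
      · exact hF'
      · exact le_rfl
  refine (mul_le_mul_of_nonneg_left h3 (by positivity)).trans (le_of_eq ?_)
  field_simp

/-- The expected regret of SHARE with bandit feedback. -/
theorem Input.coinExp_regret {ρ : ℝ} (hD : 1 ≤ diameter M) (hη : 0 ≤ η) (h0 : 0 ≤ ρ) (h1 : ρ ≤ 1)
    (hα0 : 0 < α) (hα1 : α ≤ 1) (a : ℕ → Fin ℓ) :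
    (1 - α) * (1 - Real.exp (-η)) * (1 / (2 * diameter M * ℓ)) *
        ∑ t ∈ Finset.Icc 1 I.T, coinExp I.T (I.T + m) ρ (I.exploreCost m η α t)
      ≤ η * (1 / (2 * diameter M * ℓ)) * ρ * ∑ t ∈ Finset.Icc 1 I.T, I.hcost t (a t) +
        (switches I.T a + 2) * Real.log (2 * ℓ / α) := by
  have h := coinExp_mono (T := I.T) (n := I.T + m) h0 h1
    fun b e => I.regret (m := m) (b := b) (e := e) hD hη hα0 hα1 a
  rw [coinExp_mul, coinExp_sum, coinExp_add, coinExp_const, coinExp_mul, coinExp_sum] at h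
  have hmem : ∀ t ∈ Finset.Icc 1 I.T, t ∈ Finset.Icc 1 (I.T + m) := fun t ht => by
    rw [Finset.mem_Icc] at ht ⊢; omega
  rw [Finset.sum_congr rfl fun t ht =>
    I.coinExp_loss_eq (m := m) hD (hmem t ht), ← Finset.mul_sum, ← mul_assoc] at h
  refine h.trans (add_le_add_left ?_ _)
  rw [mul_assoc, mul_assoc, Finset.mul_sum, Finset.mul_sum, ← Finset.mul_sum]
  refine mul_le_mul_of_nonneg_left ?_ hη
  rw [Finset.mul_sum]
  refine Finset.sum_le_sum fun t ht => ?_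
  exact I.coinExp_loss_comparator_le hD h0 h1 (hmem t ht) (a t)

section Expected

variable {n : ℕ} {ρ : ℝ} (hD : 1 ≤ diameter M) (hη : 0 ≤ η) (hα : 0 ≤ α) (h0 : 0 ≤ ρ)
  (h1 : ρ ≤ 1)
include hD hη hα h0 h1

/-- The distribution `x_t` depends on the recent coins, but that of time `t - 2 m` does not. Passing
to it costs `2 D` times the recent movement; then each of at most `2 m` coins contributes a factor
`ρ`, and passing back costs another `2 m ρ` times the same error. -/
theorem Input.coinExp_recentCoin_mul_le {t : ℕ} (ht : t ∈ Finset.Icc 1 I.T) :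
    coinExp I.T n ρ (fun b e => recentCoin m b t * I.staleCost m η α t t b e)
      ≤ 2 * m * ρ * coinExp I.T n ρ (I.staleCost m η α t t)
        + 2 * diameter M * (1 + 2 * m * ρ) * coinExp I.T n ρ (I.recentMovement m η α t) := by
  set s := t - 2 * m
  have hpt : ∀ b e, recentCoin m b t * I.staleCost m η α t t b e
      ≤ (∑ r ∈ Finset.Ico s t, if b r then I.staleCost m η α s t b e else 0)
        + 2 * diameter M * I.recentMovement m η α t b e := fun b e => by
    have hs := I.staleCost_le_earlier (m := m) hD hη hα ht le_rfl (Nat.sub_le t _) le_rfl b e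
    have h2 := I.recentMovement_nonneg (m := m) (η := η) (α := α) t b e
    have h3 := ite_exists_coin_mul_le (Finset.Ico s t) b
      (I.staleCost_nonneg (m := m) hD hη hα s t b e)
    refine le_trans ?_ (add_le_add_left h3 _)
    unfold recentCoin
    split_ifs
    · rw [one_mul]; exact hs
    · rw [zero_mul, zero_add]; positivity
  have hA : coinExp I.T n ρ (I.staleCost m η α s t) ≤ coinExp I.T n ρ (I.staleCost m η α t t)
      + 2 * diameter M * coinExp I.T n ρ (I.recentMovement m η α t) := by
    rw [← coinExp_mul, ← coinExp_add]
    exact coinExp_mono h0 h1 fun b e =>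
      I.staleCost_le_later hD ht le_rfl (Nat.sub_le t _) le_rfl b e
  have hB : ∑ r ∈ Finset.Ico s t,
      coinExp I.T n ρ (fun b e => if b r then I.staleCost m η α s t b e else 0)
      ≤ 2 * m * (ρ * coinExp I.T n ρ (I.staleCost m η α s t)) := by
    have hE := coinExp_nonneg (T := I.T) (n := n) h0 h1
      fun b e => I.staleCost_nonneg (m := m) hD hη hα s t b e
    calc _ ≤ ∑ r ∈ Finset.Ico s t, ρ * coinExp I.T n ρ (I.staleCost m η α s t) :=
          Finset.sum_le_sum fun r hr => coinExp_coin_le h0 h1 r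
            (fun b e => I.staleCost_nonneg hD hη hα s t b e)
            fun b e c => I.staleCost_update (Finset.mem_Ico.1 hr).1 t b e c
      _ ≤ _ := by
          rw [Finset.sum_const, nsmul_eq_mul, Nat.card_Ico]
          refine mul_le_mul_of_nonneg_right ?_ (mul_nonneg h0 hE)
          exact_mod_cast (by omega : t - s ≤ 2 * m)
  have hC := coinExp_mono (T := I.T) (n := n) h0 h1 hpt
  rw [coinExp_add, coinExp_mul, coinExp_sum] at hC
  have : (0 : ℝ) ≤ 2 * m * ρ := by positivity
  nlinarith [mul_le_mul_of_nonneg_left hA this]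

/-- With `v = t - m`, exploration at `t` occurs if `v` is an exploitation step and its coin fires,
and then `x_t = x_v`. If `v` is not an exploitation step, one of the `m` coins before it fired, and
these coins are independent of the distribution at `s = t - 2 m`. The two passages, from `x_t` to
`x_s` and from `x_s` to `x_v`, give the constant `4 D`. The condition `t > m` makes the coin at `v`
a genuine one. -/
theorem Input.coinExp_exploreCost_ge (hm : 1 ≤ m) {t : ℕ} (ht : t ∈ Finset.Icc (m + 1) I.T) :
    ρ * (1 - ρ * m) * coinExp I.T n ρ (I.staleCost m η α t t)
      ≤ coinExp I.T n ρ (I.exploreCost m η α t)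
        + 4 * diameter M * ρ * coinExp I.T n ρ (I.recentMovement m η α t) := by
  rw [Finset.mem_Icc] at ht
  have ht' : t ∈ Finset.Icc 1 I.T := Finset.mem_Icc.2 ⟨by omega, ht.2⟩
  set s := t - 2 * m with hs
  set v := t - m with hv
  have hvt : v + m = t := by omega
  let H : (ℕ → Bool) → (ℕ → Fin ℓ) → ℝ :=
    fun b e => if countdown m b v = 0 then I.staleCost m η α v t b e else 0
  have hH0 : ∀ b e, 0 ≤ H b e := fun b e => by
    simp only [H]
    split_ifs
    · exact I.staleCost_nonneg hD hη hα v t b e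
    · exact le_rfl
  have hpt : ∀ b e, I.staleCost m η α s t b e ≤ H b e
      + (∑ r ∈ Finset.Ico s v, if b r then I.staleCost m η α s t b e else 0)
      + 2 * diameter M * I.recentMovement m η α t b e := fun b e => by
    have h2 := I.recentMovement_nonneg (m := m) (η := η) (α := α) t b e
    have h3 := ite_exists_coin_mul_le (Finset.Ico s v) b
      (I.staleCost_nonneg (m := m) hD hη hα s t b e)
    have h5 : 0 ≤ 2 * diameter M * I.recentMovement m η α t b e := by positivity
    by_cases hc : countdown m b v = 0
    · have h4 := I.staleCost_le_later (m := m) (η := η) (α := α) (s := s) (s' := v) hD ht' le_rfl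
        (by omega) (by omega) b e
      have h6 : 0 ≤ if ∃ r ∈ Finset.Ico s v, b r = true then I.staleCost m η α s t b e else 0 := by
        split_ifs
        · exact I.staleCost_nonneg hD hη hα s t b e
        · exact le_rfl
      have h7 : H b e = I.staleCost m η α v t b e := if_pos hc
      linarith
    · have hex := exists_coin hc
      rw [show v - m = s by omega] at hex
      rw [if_pos hex] at h3
      linarith [hH0 b e]
  have hC := coinExp_mono (T := I.T) (n := n) h0 h1 hpt
  rw [coinExp_add, coinExp_mul, coinExp_add, coinExp_sum] at hC
  have hB : ∑ r ∈ Finset.Ico s v,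
      coinExp I.T n ρ (fun b e => if b r then I.staleCost m η α s t b e else 0)
      ≤ m * (ρ * coinExp I.T n ρ (I.staleCost m η α s t)) := by
    have hE := coinExp_nonneg (T := I.T) (n := n) h0 h1
      fun b e => I.staleCost_nonneg (m := m) hD hη hα s t b e
    calc _ ≤ ∑ r ∈ Finset.Ico s v, ρ * coinExp I.T n ρ (I.staleCost m η α s t) :=
          Finset.sum_le_sum fun r hr => coinExp_coin_le h0 h1 r
            (fun b e => I.staleCost_nonneg hD hη hα s t b e)
            fun b e c => I.staleCost_update (Finset.mem_Ico.1 hr).1 t b e c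
      _ ≤ _ := by
          rw [Finset.sum_const, nsmul_eq_mul, Nat.card_Ico]
          refine mul_le_mul_of_nonneg_right ?_ (mul_nonneg h0 hE)
          exact_mod_cast (by omega : v - s ≤ m)
  have hH : ρ * coinExp I.T n ρ H ≤ coinExp I.T n ρ (I.exploreCost m η α t) := by
    rw [← coinExp_coin (Finset.mem_Icc.2 ⟨by omega, by omega⟩ : v ∈ Finset.Icc 1 I.T)
      (fun b e c => by
        simp only [H]
        rw [countdown_update le_rfl, I.staleCost_update le_rfl])]
    refine coinExp_mono h0 h1 fun b e => ?_
    by_cases hb : b v = true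
    · by_cases hc : countdown m b v = 0
      · have h2 : countdown m b t = 1 := by rw [← hvt]; exact countdown_add_of_trigger hm hc hb
        have h3 : I.fractional m η α b e t = I.fractional m η α b e v := by
          conv_lhs => rw [← hvt]
          exact I.fractional_of_trigger hc hb
        simp only [H, exploreCost, staleCost, if_pos hb, if_pos hc, if_pos h2, h3, le_refl]
      · simp only [H, if_pos hb, if_neg hc]
        exact I.exploreCost_nonneg hD hη hα t b e
    · rw [if_neg hb]
      exact I.exploreCost_nonneg hD hη hα t b e
  have hA : coinExp I.T n ρ (I.staleCost m η α t t) ≤ coinExp I.T n ρ (I.staleCost m η α s t)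
      + 2 * diameter M * coinExp I.T n ρ (I.recentMovement m η α t) := by
    rw [← coinExp_mul, ← coinExp_add]
    exact coinExp_mono h0 h1 fun b e =>
      I.staleCost_le_earlier hD hη hα ht' le_rfl (Nat.sub_le t _) le_rfl b e
  have hM := coinExp_nonneg (T := I.T) (n := n) h0 h1
    fun b e => I.recentMovement_nonneg (m := m) (η := η) (α := α) t b e
  have hS := coinExp_nonneg (T := I.T) (n := n) h0 h1
    fun b e => I.staleCost_nonneg (m := m) hD hη hα t t b e
  have hρm : 0 ≤ ρ * m := by positivity
  set S := coinExp I.T n ρ (I.staleCost m η α s t)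
  set C := coinExp I.T n ρ (I.staleCost m η α t t)
  set R := coinExp I.T n ρ (I.recentMovement m η α t)
  set X := coinExp I.T n ρ H
  have hDR : 0 ≤ diameter M * R := by positivity
  -- If `ρ m > 1`, the left-hand side is not positive and there is nothing to prove.
  have h5 : (1 - ρ * m) * C ≤ X + 4 * diameter M * R := by
    rcases le_total (ρ * m) 1 with h | h
    · have := mul_le_mul_of_nonneg_left hA (sub_nonneg.2 h)
      nlinarith [mul_nonneg hρm hDR]
    · have hX : 0 ≤ X := coinExp_nonneg h0 h1 hH0
      nlinarith
  nlinarith [mul_le_mul_of_nonneg_left h5 h0]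

/-- The movement at time `t + 1` is caused by the loss of step `t`. Step `0` has no loss, so the
shifted sum stays within `1, …, T`. -/
theorem Input.coinExp_movement_le (hα1 : α ≤ 1) :
    ∑ u ∈ Finset.Icc 1 I.T, coinExp I.T (I.T + m) ρ (I.movement m η α u)
      ≤ η * (1 / (2 * diameter M * ℓ)) *
        ∑ t ∈ Finset.Icc 1 I.T, coinExp I.T (I.T + m) ρ (I.exploreCost m η α t) := by
  have hE : ∀ t, 0 ≤ coinExp I.T (I.T + m) ρ (I.exploreCost m η α t) := fun t =>
    coinExp_nonneg h0 h1 fun b e => I.exploreCost_nonneg hD hη hα t b e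
  have hstep : ∀ t ∈ Finset.range I.T, coinExp I.T (I.T + m) ρ (I.movement m η α (t + 1))
      ≤ η * (1 / (2 * diameter M * ℓ)) *
        (if t = 0 then 0 else coinExp I.T (I.T + m) ρ (I.exploreCost m η α t)) := by
    intro t ht
    rw [Finset.mem_range] at ht
    have h2 := coinExp_mono (T := I.T) (n := I.T + m) h0 h1
      fun b e => I.moved_fractional_le (m := m) (b := b) (e := e) hD hη hα hα1 t
    rw [coinExp_mul] at h2
    refine h2.trans ?_
    rw [mul_assoc]
    refine mul_le_mul_of_nonneg_left ?_ hη
    split_ifs with h3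
    · subst h3
      simp [loss, countdown, coinExp_const]
    · exact (I.coinExp_loss_eq hD (Finset.mem_Icc.2 ⟨by omega, by omega⟩)).le
  have hsum : ∀ f : ℕ → ℝ, ∑ u ∈ Finset.Icc 1 I.T, f u = ∑ t ∈ Finset.range I.T, f (t + 1) :=
    fun f => by
      rw [Finset.range_eq_Ico, Finset.sum_Ico_add' f 0 I.T 1]
      rfl
  rw [hsum]
  refine (Finset.sum_le_sum hstep).trans ?_
  rw [← Finset.mul_sum]
  refine mul_le_mul_of_nonneg_left ?_ (by positivity)
  rw [← Finset.sum_filter_add_sum_filter_not (Finset.range I.T) (fun t => t = 0)]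
  rw [Finset.sum_eq_zero (fun t ht => if_pos (Finset.mem_filter.1 ht).2), zero_add,
    Finset.sum_congr rfl fun t ht => if_neg (Finset.mem_filter.1 ht).2]
  refine Finset.sum_le_sum_of_subset_of_nonneg (fun t ht => ?_) fun t _ _ => hE t
  rw [Finset.mem_filter, Finset.mem_range] at ht
  rw [Finset.mem_Icc]
  omega

theorem Input.sum_coinExp_recentCoin_mul_le :
    ∑ t ∈ Finset.Icc 1 I.T,
        coinExp I.T n ρ (fun b e => recentCoin m b t * I.staleCost m η α t t b e)
      ≤ 2 * m * ρ * ∑ t ∈ Finset.Icc 1 I.T, coinExp I.T n ρ (I.staleCost m η α t t)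
        + 4 * diameter M * m * (1 + 2 * m * ρ) *
          ∑ u ∈ Finset.Icc 1 I.T, coinExp I.T n ρ (I.movement m η α u) := by
  have h2 := Finset.sum_le_sum fun t ht =>
    I.coinExp_recentCoin_mul_le (n := n) (m := m) hD hη hα h0 h1 (t := t) ht
  rw [Finset.sum_add_distrib, ← Finset.mul_sum, ← Finset.mul_sum] at h2
  have h3 := I.sum_coinExp_recentMovement_le (n := n) (m := m) (η := η) (α := α) h0 h1
  have h4 : 0 ≤ 2 * diameter M * (1 + 2 * m * ρ) := by positivity
  nlinarith [mul_le_mul_of_nonneg_left h3 h4]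

/-- The first `m` steps can never be explored properly; each is charged its trivial bound `2 D`,
whence the last term. -/
theorem Input.sum_coinExp_staleCost_le (hm : 1 ≤ m) :
    ρ * (1 - ρ * m) * ∑ t ∈ Finset.Icc 1 I.T, coinExp I.T n ρ (I.staleCost m η α t t)
      ≤ ∑ t ∈ Finset.Icc 1 I.T, coinExp I.T n ρ (I.exploreCost m η α t)
        + 8 * diameter M * m * ρ * ∑ u ∈ Finset.Icc 1 I.T, coinExp I.T n ρ (I.movement m η α u)
        + ρ * (2 * diameter M * m) := by
  have hE : ∀ t, 0 ≤ coinExp I.T n ρ (I.exploreCost m η α t) := fun t =>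
    coinExp_nonneg h0 h1 fun b e => I.exploreCost_nonneg hD hη hα t b e
  have hR : ∀ t, 0 ≤ coinExp I.T n ρ (I.recentMovement m η α t) := fun t =>
    coinExp_nonneg h0 h1 fun b e => I.recentMovement_nonneg t b e
  have hpt : ∀ t ∈ Finset.Icc 1 I.T,
      ρ * (1 - ρ * m) * coinExp I.T n ρ (I.staleCost m η α t t)
        ≤ coinExp I.T n ρ (I.exploreCost m η α t)
          + 4 * diameter M * ρ * coinExp I.T n ρ (I.recentMovement m η α t)
          + if t ≤ m then ρ * (2 * diameter M) else 0 := by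
    intro t ht
    by_cases htm : t ≤ m
    · rw [if_pos htm]
      have h2 : coinExp I.T n ρ (I.staleCost m η α t t) ≤ 2 * diameter M := by
        rw [← coinExp_const (ℓ := ℓ) (T := I.T) (n := n) (ρ := ρ) (2 * diameter M)]
        exact coinExp_mono h0 h1 fun b e => I.staleCost_le hD hη hα ht t b e
      have h3 : 0 ≤ coinExp I.T n ρ (I.staleCost m η α t t) :=
        coinExp_nonneg h0 h1 fun b e => I.staleCost_nonneg hD hη hα t t b e
      have h4 : 0 ≤ 4 * diameter M * ρ * coinExp I.T n ρ (I.recentMovement m η α t) := by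
        have := hR t; positivity
      have h5 : (1 - ρ * m) * coinExp I.T n ρ (I.staleCost m η α t t) ≤ 2 * diameter M := by
        nlinarith [mul_nonneg (mul_nonneg h0 (Nat.cast_nonneg (α := ℝ) m)) h3]
      nlinarith [hE t, mul_le_mul_of_nonneg_left h5 h0]
    · rw [if_neg htm, add_zero]
      exact I.coinExp_exploreCost_ge hD hη hα h0 h1 hm
        (Finset.mem_Icc.2 ⟨by omega, (Finset.mem_Icc.1 ht).2⟩)
  have h2 := Finset.sum_le_sum hpt
  rw [Finset.sum_add_distrib, Finset.sum_add_distrib, ← Finset.mul_sum, ← Finset.mul_sum] at h2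
  have h3 := I.sum_coinExp_recentMovement_le (n := n) (m := m) (η := η) (α := α) h0 h1
  have h4 : ∑ t ∈ Finset.Icc 1 I.T, (if t ≤ m then ρ * (2 * diameter M) else 0)
      ≤ ρ * (2 * diameter M * m) := by
    rw [← Finset.sum_filter, Finset.sum_const, nsmul_eq_mul]
    have h5 : (Finset.Icc 1 I.T).filter (fun t => t ≤ m) ⊆ Finset.Icc 1 m := fun t => by
      simp only [Finset.mem_filter, Finset.mem_Icc]; omega
    have h6 := Finset.card_le_card h5
    rw [Nat.card_Icc, Nat.add_sub_cancel] at h6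
    have h7 : (((Finset.Icc 1 I.T).filter fun t => t ≤ m).card : ℝ) ≤ m := by exact_mod_cast h6
    have h8 : 0 ≤ ρ * (2 * diameter M) := by positivity
    nlinarith
  have h5 : 0 ≤ 4 * diameter M * ρ := by positivity
  nlinarith [mul_le_mul_of_nonneg_left h3 h5]

end Expected

end

/-! ### Sums that are reset when no coin was tossed recently -/

/-- The solution of `z (t + 1) = V (t + 1) * z t + Y (t + 1)` with `z 0 = 0`. -/
def damped (V Y : ℕ → ℝ) : ℕ → ℝ
  | 0 => 0
  | t + 1 => V (t + 1) * damped V Y t + Y (t + 1)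

theorem damped_nonneg {V Y : ℕ → ℝ} (hV : ∀ t, 0 ≤ V t) (hY : ∀ t, 0 ≤ Y t) (t : ℕ) :
    0 ≤ damped V Y t := by
  induction t with
  | zero => exact le_rfl
  | succ t ih => exact add_nonneg (mul_nonneg (hV _) ih) (hY _)

theorem le_damped {V Y : ℕ → ℝ} (hV : ∀ t, 0 ≤ V t) (hY : ∀ t, 0 ≤ Y t) (t : ℕ) :
    Y (t + 1) ≤ damped V Y (t + 1) :=
  le_add_of_nonneg_left (mul_nonneg (hV _) (damped_nonneg hV hY t))

theorem damped_congr {V V' Y Y' : ℕ → ℝ} {t : ℕ} (hV : ∀ s ≤ t, V s = V' s)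
    (hY : ∀ s ≤ t, Y s = Y' s) : damped V Y t = damped V' Y' t := by
  induction t with
  | zero => rfl
  | succ t ih =>
    rw [damped, damped, hV _ le_rfl, hY _ le_rfl, ih (fun s hs => hV s (hs.trans t.le_succ))
      fun s hs => hY s (hs.trans t.le_succ)]

theorem recentCoin_update {m t r : ℕ} (h : t ≤ r) (b : ℕ → Bool) (c : Bool) :
    recentCoin m (Function.update b r c) t = recentCoin m b t := by
  unfold recentCoin
  congr 1
  refine propext (exists_congr fun s => and_congr_right fun hs => ?_)
  rw [Function.update_of_ne (by have := (Finset.mem_Ico.1 hs).2; omega)]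

/-- An upper bound on the number of further times at which a recent coin is remembered. -/
def memory (m : ℕ) (b : ℕ → Bool) : ℕ → ℕ
  | 0 => 0
  | t + 1 => if b t then 2 * m else memory m b t - 1

theorem memory_le (m : ℕ) (b : ℕ → Bool) (t : ℕ) : memory m b t ≤ 2 * m := by
  induction t with
  | zero => exact Nat.zero_le _
  | succ t ih => rw [memory]; split_ifs <;> omega

theorem memory_ge {m : ℕ} {b : ℕ → Bool} {r t : ℕ} (h : r < t) (hb : b r = true) :
    r + 2 * m + 1 ≤ memory m b t + t := by
  induction t with
  | zero => omega
  | succ t ih =>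
    rw [memory]
    split_ifs with hbt
    · omega
    · have hrt : r ≠ t := fun h => hbt (h ▸ hb)
      have := ih (by omega)
      omega

/-- Unless a new coin fires, a remembered coin ages by one step, so `2 * memory + 1` drops by two;
otherwise the factor `recentCoin` vanishes. -/
theorem recentCoin_mul_memory_le (m : ℕ) (b : ℕ → Bool) (t : ℕ) :
    recentCoin m b (t + 1) * (2 * memory m b (t + 1) + 1)
      ≤ (if b t then (4 * m + 1 : ℝ) else 0) + 2 * memory m b t := by
  have h0 : (0 : ℝ) ≤ 2 * memory m b t := by positivity
  by_cases hb : b t = true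
  · rw [if_pos hb, memory, if_pos hb]
    have h1 := recentCoin_le_one m b (t + 1)
    push_cast
    nlinarith [Nat.cast_nonneg (α := ℝ) m]
  · rw [if_neg hb, zero_add]
    unfold recentCoin
    split_ifs with h
    · obtain ⟨r, hr, hbr⟩ := h
      rw [Finset.mem_Ico] at hr
      have h1 := memory_ge (m := m) hr.2 hbr
      have h2 : memory m b (t + 1) = memory m b t - 1 := by rw [memory, if_neg hb]
      have h3 : memory m b (t + 1) + 1 = memory m b t := by omega
      rw [← h3]
      push_cast
      linarith
    · rw [zero_mul]; exact h0

theorem sum_coinExp_damped_le {ℓ : ℕ} [NeZero ℓ] {T n m : ℕ} {ρ : ℝ} (h0 : 0 ≤ ρ) (h1 : ρ ≤ 1)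
    (hm : 1 ≤ m) (hρ : ρ * (4 * m + 1) ≤ 1 / 2) {Y : ℕ → (ℕ → Bool) → (ℕ → Fin ℓ) → ℝ}
    (hY0 : ∀ t b e, 0 ≤ Y t b e)
    (hY : ∀ t r, t ≤ r → ∀ b e c, Y t (Function.update b r c) e = Y t b e) :
    ∑ t ∈ Finset.Icc 1 T,
        coinExp T n ρ (fun b e => damped (recentCoin m b) (fun s => Y s b e) t)
      ≤ 10 * m * ∑ t ∈ Finset.Icc 1 T, coinExp T n ρ (Y t) := by
  let z : ℕ → (ℕ → Bool) → (ℕ → Fin ℓ) → ℝ :=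
    fun t b e => damped (recentCoin m b) (fun s => Y s b e) t
  have hz0 : ∀ t b e, 0 ≤ z t b e := fun t b e =>
    damped_nonneg (recentCoin_nonneg m b) (fun s => hY0 s b e) t
  have hz : ∀ t r, t ≤ r → ∀ b e c, z t (Function.update b r c) e = z t b e :=
    fun t r h b e c => damped_congr (fun s hs => recentCoin_update (hs.trans h) b c)
      fun s hs => hY s r (hs.trans h) b e c
  -- The potential weighs the accumulated sum by its remaining lifetime. Each step it loses at least
  -- `z t`, apart from new input and from a firing coin. That coin is independent of `z t`, so by
  -- `hρ` it restores at most half of the loss in expectation.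
  let Φ : ℕ → (ℕ → Bool) → (ℕ → Fin ℓ) → ℝ := fun t b e => z t b e * (2 * memory m b t + 1)
  have hstep : ∀ t, coinExp T n ρ (Φ (t + 1))
      ≤ (4 * m + 1) * coinExp T n ρ (Y (t + 1)) + coinExp T n ρ (Φ t)
        - 1 / 2 * coinExp T n ρ (z t) := by
    intro t
    have hpt : ∀ b e, Φ (t + 1) b e ≤ (4 * m + 1) * Y (t + 1) b e + Φ t b e + (-1) * z t b e
        + (4 * m + 1) * (if b t then z t b e else 0) := fun b e => by
      have h2 := mul_le_mul_of_nonneg_left (recentCoin_mul_memory_le m b t) (hz0 t b e)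
      have h3 : (memory m b (t + 1) : ℝ) ≤ 2 * m := by exact_mod_cast memory_le m b (t + 1)
      have h4 := mul_le_mul_of_nonneg_left
        (show 2 * (memory m b (t + 1) : ℝ) + 1 ≤ 4 * m + 1 by linarith) (hY0 (t + 1) b e)
      have h5 : (4 * m + 1 : ℝ) * (if b t then z t b e else 0)
          = z t b e * (if b t then (4 * m + 1 : ℝ) else 0) := by split_ifs <;> ring
      rw [h5]
      have h6 : Φ (t + 1) b e = z t b e *
          (recentCoin m b (t + 1) * (2 * memory m b (t + 1) + 1))
          + Y (t + 1) b e * (2 * memory m b (t + 1) + 1) := by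
        simp only [Φ, z, damped]; ring
      rw [h6]
      simp only [Φ]
      linarith
    have h2 := coinExp_mono (T := T) (n := n) h0 h1 hpt
    rw [coinExp_add, coinExp_add, coinExp_add, coinExp_mul, coinExp_mul, coinExp_mul] at h2
    have h3 := coinExp_coin_le (T := T) (n := n) h0 h1 t (hz0 t) (hz t t le_rfl)
    have h4 : 0 ≤ coinExp T n ρ (z t) := coinExp_nonneg h0 h1 (hz0 t)
    have h5 := mul_le_mul_of_nonneg_left h3 (show (0 : ℝ) ≤ 4 * m + 1 by positivity)
    nlinarith
  have key : ∀ N, coinExp T n ρ (Φ N) + 1 / 2 * ∑ t ∈ Finset.range N, coinExp T n ρ (z t)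
      ≤ (4 * m + 1) * ∑ t ∈ Finset.Icc 1 N, coinExp T n ρ (Y t) := by
    intro N
    induction N with
    | zero => simp [Φ, z, damped, coinExp_const]
    | succ N ih =>
      rw [Finset.sum_range_succ, Finset.sum_Icc_succ_top (by omega)]
      linarith [hstep N]
  have h2 : coinExp T n ρ (z T) ≤ coinExp T n ρ (Φ T) :=
    coinExp_mono h0 h1 fun b e => by
      have h3 : (0 : ℝ) ≤ memory m b T := Nat.cast_nonneg _
      simp only [Φ]
      nlinarith [hz0 T b e]
  have h3 : ∑ t ∈ Finset.Icc 1 T, coinExp T n ρ (z t)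
      ≤ ∑ t ∈ Finset.range (T + 1), coinExp T n ρ (z t) :=
    Finset.sum_le_sum_of_subset_of_nonneg
      (fun t ht => by rw [Finset.mem_Icc] at ht; rw [Finset.mem_range]; omega)
      fun t _ _ => coinExp_nonneg h0 h1 (hz0 t)
  rw [Finset.sum_range_succ] at h3
  have h4 : 0 ≤ ∑ t ∈ Finset.Icc 1 T, coinExp T n ρ (Y t) :=
    Finset.sum_nonneg fun t _ => coinExp_nonneg h0 h1 (hY0 t)
  have h5 : 0 ≤ coinExp T n ρ (z T) := coinExp_nonneg h0 h1 (hz0 T)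
  have h6 : (1 : ℝ) ≤ m := by exact_mod_cast hm
  refine h3.trans ?_
  nlinarith [key T]

/-! ### The cost of the algorithm for fixed random choices -/

section Deterministic

variable {M : Type*} [MetricSpace M] {ℓ : ℕ} (I : Input M ℓ) {m : ℕ} {b : ℕ → Bool}
  {e a : ℕ → Fin ℓ}

/-- Indicator of a switch of `a` at time `t`. -/
def switchAt (a : ℕ → Fin ℓ) (t : ℕ) : ℝ := if a (t - 1) ≠ a t then 1 else 0

theorem switchAt_nonneg (a : ℕ → Fin ℓ) (t : ℕ) : 0 ≤ switchAt a t := by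
  unfold switchAt; split_ifs <;> norm_num

/-- The number of switches at the last `m` times, plus one in the start-up phase. -/
def unsettled (m : ℕ) (a : ℕ → Fin ℓ) (t : ℕ) : ℝ :=
  (if t + 1 < m then 1 else 0) + ∑ u ∈ Finset.Ioc (t - m) t, switchAt a u

theorem unsettled_nonneg (m : ℕ) (a : ℕ → Fin ℓ) (t : ℕ) : 0 ≤ unsettled m a t :=
  add_nonneg (by split_ifs <;> norm_num) (Finset.sum_nonneg fun u _ => switchAt_nonneg a u)

theorem one_le_unsettled_of_switch {u t : ℕ} (h1 : t - m < u) (h2 : u ≤ t)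
    (h : a (u - 1) ≠ a u) : 1 ≤ unsettled m a t := by
  have h3 : switchAt a u ≤ ∑ u ∈ Finset.Ioc (t - m) t, switchAt a u :=
    Finset.single_le_sum (fun u _ => switchAt_nonneg a u) (Finset.mem_Ioc.2 ⟨h1, h2⟩)
  rw [switchAt, if_pos h] at h3
  refine h3.trans (le_add_of_nonneg_left ?_)
  split_ifs <;> norm_num

theorem exists_switch {u t : ℕ} (h : u ≤ t) (hne : a u ≠ a t) :
    ∃ w, u < w ∧ w ≤ t ∧ a (w - 1) ≠ a w := by
  induction t, h using Nat.le_induction with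
  | base => exact absurd rfl hne
  | succ t h ih =>
    by_cases hs : a t = a (t + 1)
    · obtain ⟨w, h1, h2, h3⟩ := ih (by rwa [hs])
      exact ⟨w, h1, by omega, h3⟩
    · exact ⟨t + 1, by omega, le_rfl, by simpa using hs⟩

/-- Past the start-up, some query in the last `m - 1` steps differs from `a t`. In an exploitation
step this forces a later switch. In a block the triggering coin is at most `m` steps older than the
query, hence the window `2 m` in `recentCoin`. -/
theorem recentCoin_or_unsettled {t : ℕ} (h : ¬ Known m (query m b e a) (a t) t) :
    recentCoin m b t = 1 ∨ 1 ≤ unsettled m a t := by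
  by_cases hm : m ≤ t + 1
  · have h2 : ∃ u ∈ Finset.Icc (t + 2 - m) t, query m b e a u ≠ a t := by
      by_contra hcon
      push Not at hcon
      exact h ⟨hm, hcon⟩
    obtain ⟨u, hu, hne⟩ := h2
    rw [Finset.mem_Icc] at hu
    unfold query at hne
    split_ifs at hne with hc
    · right
      obtain ⟨w, h1, h2, h3⟩ := exists_switch hu.2 hne
      exact one_le_unsettled_of_switch (by omega) h2 h3
    · left
      obtain ⟨r, hr, hb⟩ := exists_coin hc
      rw [Finset.mem_Ico] at hr
      exact if_pos ⟨r, Finset.mem_Ico.2 ⟨by omega, by omega⟩, hb⟩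
  · right
    rw [unsettled, if_pos (by omega)]
    exact le_add_of_nonneg_right (Finset.sum_nonneg fun u _ => switchAt_nonneg a u)

theorem edist_le_diameter (hD : 1 ≤ diameter M) (x y : M) :
    edist x y ≤ ENNReal.ofReal (diameter M) := by
  -- An unbounded space would have real diameter `0`, so `1 ≤ D` already implies boundedness.
  have h : Metric.ediam (Set.univ : Set M) ≠ ⊤ := fun h => by
    rw [diameter, Metric.diam, h] at hD
    norm_num at hD
  rw [diameter, Metric.diam, ENNReal.ofReal_toReal h]
  exact Metric.edist_le_ediam_of_mem (Set.mem_univ x) (Set.mem_univ y)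

theorem dist_le_diameter (hD : 1 ≤ diameter M) (x y : M) : dist x y ≤ diameter M := by
  have h := edist_le_diameter hD x y
  rwa [edist_dist, ENNReal.ofReal_le_ofReal_iff (by linarith)] at h

/-- The part of the overhead of the algorithm that is caused at time `t`. -/
def Input.overhead (m : ℕ) (b : ℕ → Bool) (a : ℕ → Fin ℓ) (t : ℕ) : ℝ :=
  recentCoin m b t * I.hcost t (a t) + diameter M * unsettled m a t

theorem Input.overhead_nonneg (hD : 1 ≤ diameter M) (t : ℕ) : 0 ≤ I.overhead m b a t :=
  add_nonneg (mul_nonneg (recentCoin_nonneg m b t) (I.hcost_nonneg t _))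
    (mul_nonneg (by linarith) (unsettled_nonneg m a t))

/-- The accumulated overhead. -/
def Input.debt (m : ℕ) (b : ℕ → Bool) (a : ℕ → Fin ℓ) : ℕ → ℝ :=
  damped (recentCoin m b) (I.overhead m b a)

theorem Input.debt_nonneg (hD : 1 ≤ diameter M) (t : ℕ) : 0 ≤ I.debt m b a t :=
  damped_nonneg (recentCoin_nonneg m b) (fun _ => I.overhead_nonneg hD _) t

theorem Input.overhead_le_debt (hD : 1 ≤ diameter M) (t : ℕ) :
    I.overhead m b a (t + 1) ≤ I.debt m b a (t + 1) :=
  le_damped (Y := I.overhead m b a) (recentCoin_nonneg m b) (fun _ => I.overhead_nonneg hD _) t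

theorem Input.hcost_eq {t : ℕ} (ht : t + 1 ∈ Finset.Icc 1 I.T) (i : Fin ℓ) :
    I.hcost (t + 1) i = (I.cost (t + 1) (I.state (t + 1) i)).toReal
      + dist (I.state t i) (I.state (t + 1) i) ∧ I.cost (t + 1) (I.state (t + 1) i) ≠ ⊤ := by
  have h := ne_top_of_le_ne_top ENNReal.ofReal_ne_top (I.heuristicCost_le ht i)
  rw [heuristicCost, ENNReal.add_ne_top] at h
  refine ⟨?_, h.1⟩
  rw [hcost, heuristicCost, ENNReal.toReal_add h.1 h.2, Nat.add_sub_cancel, edist_dist,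
    ENNReal.toReal_ofReal dist_nonneg]

theorem Input.dist_state_le (hD : 1 ≤ diameter M) {t : ℕ} (ht : t + 1 ∈ Finset.Icc 1 I.T) :
    (I.cost (t + 1) (I.state (t + 1) (a (t + 1)))).toReal
        + dist (I.state t (a t)) (I.state (t + 1) (a (t + 1)))
      ≤ I.hcost (t + 1) (a (t + 1)) + diameter M * switchAt a (t + 1) := by
  have h1 := (I.hcost_eq ht (a (t + 1))).1
  rw [switchAt, Nat.add_sub_cancel]
  split_ifs with h
  · have := dist_le_diameter hD (I.state t (a t)) (I.state t (a (t + 1)))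
    have := dist_triangle (I.state t (a t)) (I.state t (a (t + 1)))
      (I.state (t + 1) (a (t + 1)))
    linarith
  · rw [not_not] at h
    rw [h]
    linarith

/-- When the state is unknown, either `unsettled ≥ 1`, and the overhead contains a full diameter, or
a coin is recent and nothing has just switched. In the latter case the distance grows by at most the
heuristic's cost, exactly as the recursion for the debt does. -/
theorem Input.dist_lastKnown_le (hD : 1 ≤ diameter M) {t : ℕ} (ht : t ≤ I.T) :
    dist (I.lastKnown m (query m b e a) a t) (I.state t (a t)) ≤ I.debt m b a t := by
  induction t with
  | zero => simp [lastKnown, I.state_zero, debt, damped]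
  | succ t ih =>
    rw [lastKnown]
    split_ifs with hk
    · rw [dist_self]; exact I.debt_nonneg hD _
    · by_cases hu : 1 ≤ unsettled m a (t + 1)
      · have h1 := dist_le_diameter hD (I.lastKnown m (query m b e a) a t)
          (I.state (t + 1) (a (t + 1)))
        have h2 := I.overhead_le_debt (m := m) (b := b) (a := a) hD t
        have h3 := mul_nonneg (recentCoin_nonneg m b (t + 1))
          (I.hcost_nonneg (t + 1) (a (t + 1)))
        unfold overhead at h2
        nlinarith
      · have hV := (recentCoin_or_unsettled hk).resolve_right hu
        have hs : switchAt a (t + 1) = 0 := by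
          rw [switchAt, if_neg]
          intro hne
          refine hu (one_le_unsettled_of_switch ?_ le_rfl hne)
          rcases m with _ | m
          · exact absurd hV (by simp [recentCoin])
          · omega
        have h1 := I.dist_state_le (a := a) hD (Finset.mem_Icc.2 ⟨by omega, ht⟩)
        rw [hs, mul_zero, add_zero] at h1
        have h2 := dist_triangle (I.lastKnown m (query m b e a) a t) (I.state t (a t))
          (I.state (t + 1) (a (t + 1)))
        have h3 := ENNReal.toReal_nonneg (a := I.cost (t + 1) (I.state (t + 1) (a (t + 1))))
        have h4 : I.debt m b a (t + 1) = I.debt m b a t + (I.hcost (t + 1) (a (t + 1))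
            + diameter M * unsettled m a (t + 1)) := by
          simp only [debt, damped, overhead, hV, one_mul]
        have h5 := mul_nonneg (show 0 ≤ diameter M by linarith) (unsettled_nonneg m a (t + 1))
        linarith [ih (by omega)]

variable {greedy : ℕ → M → M}

theorem Input.cost_position_le (hg : I.IsGreedy greedy) (hD : 1 ≤ diameter M) {t : ℕ}
    (ht : t + 1 ≤ I.T) :
    I.cost (t + 1) (I.position m greedy (query m b e a) a (t + 1))
        + edist (I.lastKnown m (query m b e a) a (t + 1))
          (I.position m greedy (query m b e a) a (t + 1))
      ≤ ENNReal.ofReal (I.debt m b a (t + 1)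
          + (I.cost (t + 1) (I.state (t + 1) (a (t + 1)))).toReal) := by
  have hT : t + 1 ∈ Finset.Icc 1 I.T := Finset.mem_Icc.2 ⟨by omega, ht⟩
  have h1 := I.dist_lastKnown_le (m := m) (b := b) (e := e) (a := a) hD ht
  have h2 : I.cost (t + 1) (I.position m greedy (query m b e a) a (t + 1))
        + edist (I.lastKnown m (query m b e a) a (t + 1))
          (I.position m greedy (query m b e a) a (t + 1))
      ≤ edist (I.lastKnown m (query m b e a) a (t + 1)) (I.state (t + 1) (a (t + 1)))
        + I.cost (t + 1) (I.state (t + 1) (a (t + 1))) := by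
    by_cases hk : Known m (query m b e a) (a (t + 1)) (t + 1)
    · rw [position, lastKnown, if_pos hk, if_pos hk, add_comm]
    · rw [position, if_neg hk, add_comm]
      exact hg (t + 1) hT _ _
  refine h2.trans ?_
  rw [ENNReal.ofReal_add (I.debt_nonneg hD _) ENNReal.toReal_nonneg,
    ENNReal.ofReal_toReal (I.hcost_eq hT _).2, edist_dist]
  gcongr

/-- In an unknown step the overhead is at least half of the heuristic's cost: it contains either
that cost itself or `D`, and costs are at most `2 D`. So the greedy bound, debt plus cost, is at
most three debts. -/
theorem Input.edist_lastKnown_position_le (hg : I.IsGreedy greedy) (hD : 1 ≤ diameter M) {t : ℕ}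
    (ht : t ≤ I.T) :
    edist (I.lastKnown m (query m b e a) a t) (I.position m greedy (query m b e a) a t)
      ≤ ENNReal.ofReal (3 * I.debt m b a t) := by
  rcases t with _ | t
  · simp [lastKnown, position]
  · by_cases hk : Known m (query m b e a) (a (t + 1)) (t + 1)
    · rw [position, lastKnown, if_pos hk, if_pos hk, edist_self]
      exact zero_le
    · have hT : t + 1 ∈ Finset.Icc 1 I.T := Finset.mem_Icc.2 ⟨by omega, ht⟩
      refine (le_add_self.trans (I.cost_position_le hg hD ht)).trans
        (ENNReal.ofReal_le_ofReal ?_)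
      have h1 := I.overhead_le_debt (m := m) (b := b) (a := a) hD t
      have h2 := (I.hcost_eq hT (a (t + 1))).1
      have h3 := I.hcost_le hD hT (a (t + 1))
      have h4 := I.hcost_nonneg (t + 1) (a (t + 1))
      have h5 : 0 ≤ dist (I.state t (a (t + 1))) (I.state (t + 1) (a (t + 1))) := dist_nonneg
      have h6 := unsettled_nonneg m a (t + 1)
      have h7 := recentCoin_nonneg m b (t + 1)
      have h8 := mul_nonneg h7 h4
      have h9 := mul_nonneg (show 0 ≤ diameter M by linarith) h6
      have h10 : I.hcost (t + 1) (a (t + 1)) ≤ 2 * I.overhead m b a (t + 1) := by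
        unfold overhead
        rcases recentCoin_or_unsettled hk with h | h
        · rw [h]; linarith
        · nlinarith
      linarith

/-- The move from `s_{t-1}` to `s_t` is routed through the last known states `b_{t-1}` and `b_t`.
This uses one debt of time `t` and `3 + 1` of time `t - 1`; shifting the sum, with zero initial
debt, gives five. -/
theorem Input.algCost_le (hg : I.IsGreedy greedy) (hD : 1 ≤ diameter M) :
    I.algCost m greedy b e a ≤ ENNReal.ofReal (∑ t ∈ Finset.Icc 1 I.T,
      (I.hcost t (a t) + diameter M * switchAt a t + 5 * I.debt m b a t)) := by
  have hz := I.debt_nonneg (m := m) (b := b) (a := a) hD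
  have hF := I.hcost_nonneg
  have hS := fun t => mul_nonneg (show 0 ≤ diameter M by linarith) (switchAt_nonneg a t)
  have hstep : ∀ t ∈ Finset.Icc 1 I.T,
      I.cost t (I.position m greedy (query m b e a) a t)
        + edist (I.position m greedy (query m b e a) a (t - 1))
          (I.position m greedy (query m b e a) a t)
      ≤ ENNReal.ofReal (I.hcost t (a t) + diameter M * switchAt a t + I.debt m b a t
          + 4 * I.debt m b a (t - 1)) := by
    intro t ht
    obtain ⟨s, rfl⟩ : ∃ s, t = s + 1 := ⟨t - 1, by rw [Finset.mem_Icc] at ht; omega⟩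
    rw [Nat.add_sub_cancel]
    have hs := (Finset.mem_Icc.1 ht).2
    set q := query m b e a
    set p := I.position m greedy q a
    set B := I.lastKnown m q a
    have h1 : I.cost (s + 1) (p (s + 1)) + edist (B (s + 1)) (p (s + 1)) ≤ _ :=
      I.cost_position_le hg hD hs
    have h2 : edist (B s) (p s) ≤ _ := I.edist_lastKnown_position_le hg hD (by omega)
    have h3 : edist (B s) (B (s + 1)) ≤ ENNReal.ofReal (I.debt m b a s
        + dist (I.state s (a s)) (I.state (s + 1) (a (s + 1)))) := by
      by_cases hk : Known m q (a (s + 1)) (s + 1)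
      · have : B (s + 1) = I.state (s + 1) (a (s + 1)) := if_pos hk
        rw [this, edist_dist]
        refine ENNReal.ofReal_le_ofReal ((dist_triangle _ (I.state s (a s)) _).trans ?_)
        exact add_le_add_left (I.dist_lastKnown_le hD (by omega)) _
      · have : B (s + 1) = B s := if_neg hk
        rw [this, edist_self]
        exact zero_le
    have h4 := I.dist_state_le (a := a) hD ht
    calc I.cost (s + 1) (p (s + 1)) + edist (p s) (p (s + 1))
        ≤ I.cost (s + 1) (p (s + 1))
          + (edist (p s) (B s) + edist (B s) (B (s + 1)) + edist (B (s + 1)) (p (s + 1))) := by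
          gcongr
          exact edist_triangle4 _ _ _ _
      _ = (I.cost (s + 1) (p (s + 1)) + edist (B (s + 1)) (p (s + 1)))
          + edist (B s) (B (s + 1)) + edist (B s) (p s) := by
          rw [edist_comm (p s)]; ring
      _ ≤ _ := add_le_add (add_le_add h1 h3) h2
      _ ≤ _ := by
          rw [← ENNReal.ofReal_add (add_nonneg (hz _) ENNReal.toReal_nonneg)
              (add_nonneg (hz _) dist_nonneg),
            ← ENNReal.ofReal_add (add_nonneg (add_nonneg (hz _) ENNReal.toReal_nonneg)
              (add_nonneg (hz _) dist_nonneg)) (mul_nonneg (by norm_num) (hz _))]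
          exact ENNReal.ofReal_le_ofReal (by linarith)
  refine (Finset.sum_le_sum hstep).trans ?_
  rw [← ENNReal.ofReal_sum_of_nonneg fun t _ => by linarith [hz t, hz (t - 1), hF t (a t), hS t]]
  refine ENNReal.ofReal_le_ofReal ?_
  have h1 : ∑ t ∈ Finset.Icc 1 I.T, I.debt m b a (t - 1)
      ≤ ∑ t ∈ Finset.Icc 1 I.T, I.debt m b a t := by
    have hsum : ∀ f : ℕ → ℝ,
        ∑ u ∈ Finset.Icc 1 I.T, f u = ∑ t ∈ Finset.range I.T, f (t + 1) := fun f => by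
      rw [Finset.range_eq_Ico, Finset.sum_Ico_add' f 0 I.T 1]
      rfl
    rw [hsum, hsum]
    simp only [Nat.add_sub_cancel]
    have h2 := Finset.sum_range_succ (I.debt m b a) I.T
    rw [Finset.sum_range_succ'] at h2
    have h3 : I.debt m b a 0 = 0 := rfl
    linarith [hz I.T]
  simp only [Finset.sum_add_distrib, ← Finset.mul_sum] at h1 ⊢
  linarith

end Deterministic

/-! ### The rounded solution and the expected cost of the algorithm -/

section Rounding

variable {ℓ : ℕ} {τ : (Fin ℓ → ℝ) → (Fin ℓ → ℝ) → Fin ℓ → Fin ℓ → ℝ}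
  {p p' : Fin ℓ → ℝ}

theorem sum_mul_transition (hτ : IsTransport p p' (τ p p')) (hp : ∀ i, 0 < p i) (j : Fin ℓ) :
    ∑ i, p i * transition τ p p' i j = p' j := by
  unfold transition
  split_ifs with h
  · rw [← hτ.col j]
    exact Finset.sum_congr rfl fun i _ => mul_div_cancel₀ _ (hp i).ne'
  · rw [not_not] at h
    rw [h]
    simp

theorem sum_transition (hτ : IsTransport p p' (τ p p')) (hp : ∀ i, 0 < p i) (i : Fin ℓ) :
    ∑ j, transition τ p p' i j = 1 := by
  unfold transition
  split_ifs with h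
  · rw [← Finset.sum_div, hτ.row i, div_self (hp i).ne']
  · simp

theorem transition_nonneg (hτ : IsTransport p p' (τ p p')) (hp : ∀ i, 0 < p i) (i j : Fin ℓ) :
    0 ≤ transition τ p p' i j := by
  unfold transition
  split_ifs
  · exact div_nonneg (hτ.nonneg i j) (hp i).le
  · exact zero_le_one
  · exact le_rfl

/-- Here the optimality of the transport plan enters. -/
theorem sum_switch_transition (hτ : IsTransport p p' (τ p p')) (hp : ∀ i, 0 < p i) :
    ∑ i, ∑ j, p i * transition τ p p' i j * (if i ≠ j then 1 else 0) = moved p p' := by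
  unfold transition
  split_ifs with h
  · rw [moved, ← hτ.moved]
    refine Finset.sum_congr rfl fun i _ => ?_
    rw [← Finset.add_sum_erase _ _ (Finset.mem_univ i), if_neg (by simp), mul_zero, zero_add]
    refine Finset.sum_congr rfl fun j hj => ?_
    rw [if_pos (Finset.ne_of_mem_erase hj).symm, mul_one, mul_div_cancel₀ _ (hp i).ne']
  · rw [not_not] at h
    rw [h, moved_self]
    refine Finset.sum_eq_zero fun i _ => Finset.sum_eq_zero fun j _ => ?_
    by_cases hij : i = j
    · simp [hij]
    · simp [Ne.symm hij]

end Rounding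

section Rounded

variable {M : Type*} [MetricSpace M] {ℓ : ℕ} (I : Input M ℓ) {m : ℕ} {η α : ℝ}
  {τ : (Fin ℓ → ℝ) → (Fin ℓ → ℝ) → Fin ℓ → Fin ℓ → ℝ} {b : ℕ → Bool} {e : ℕ → Fin ℓ}

theorem Input.fractional_zero (i : Fin ℓ) : I.fractional m η α b e 0 i = 1 / ℓ := by
  simp [fractional, weights]

variable [NeZero ℓ]

/-- The probability of a sequence of exploited heuristics given the other random choices. -/
def Input.roundingWeight (m : ℕ) (η α : ℝ) (τ : (Fin ℓ → ℝ) → (Fin ℓ → ℝ) → Fin ℓ → Fin ℓ → ℝ)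
    (b : ℕ → Bool) (e : ℕ → Fin ℓ) (a : ℕ → Fin ℓ) : ℝ :=
  pathWeight (I.fractional m η α b e 0)
    (fun t => transition τ (I.fractional m η α b e (t - 1)) (I.fractional m η α b e t)) I.T a

theorem Input.prob_eq (ρ : ℝ) (β : Fin I.T → Bool) (e : Fin (I.T + m) → Fin ℓ)
    (a : Fin (I.T + 1) → Fin ℓ) : I.prob m ρ η α τ β e a
      = coinWeight ρ β e * I.roundingWeight m η α τ (fromOne β) (fromOne e) (fromZero a) := by
  rw [prob, coinWeight, roundingWeight, pathWeight, fractional_zero]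
  ring

/-- The expected part of the overhead that is caused at time `t`, given the coins and the
explored heuristics. -/
def Input.meanOverhead (m : ℕ) (η α : ℝ) (t : ℕ) (b : ℕ → Bool) (e : ℕ → Fin ℓ) : ℝ :=
  recentCoin m b t * I.staleCost m η α t t b e + diameter M *
    ((if t + 1 < m then 1 else 0) + ∑ u ∈ Finset.Ioc (t - m) t, I.movement m η α u b e)

/-- The expected accumulated overhead, given the coins and the explored heuristics. -/
def Input.meanDebt (m : ℕ) (η α : ℝ) (t : ℕ) (b : ℕ → Bool) (e : ℕ → Fin ℓ) : ℝ :=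
  damped (recentCoin m b) (fun s => I.meanOverhead m η α s b e) t

theorem Input.sum_meanDebt_le {ρ : ℝ} (hD : 1 ≤ diameter M) (hη : 0 ≤ η) (hα : 0 ≤ α)
    (h0 : 0 ≤ ρ) (h1 : ρ ≤ 1) (hm : 1 ≤ m)
    (hρ : ρ * (4 * m + 1) ≤ 1 / 2) :
    ∑ t ∈ Finset.Icc 1 I.T, coinExp I.T (I.T + m) ρ (I.meanDebt m η α t)
      ≤ 10 * m * (2 * m * ρ *
          ∑ t ∈ Finset.Icc 1 I.T, coinExp I.T (I.T + m) ρ (I.staleCost m η α t t)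
        + 7 * diameter M * m *
          ∑ u ∈ Finset.Icc 1 I.T, coinExp I.T (I.T + m) ρ (I.movement m η α u)
        + diameter M * m) := by
  have hN : 0 ≤ ∑ u ∈ Finset.Icc 1 I.T, coinExp I.T (I.T + m) ρ (I.movement m η α u) :=
    Finset.sum_nonneg fun u _ => coinExp_nonneg h0 h1 (I.movement_nonneg u)
  refine (sum_coinExp_damped_le h0 h1 hm hρ (fun t b e => ?_) fun t r h b e c => ?_).trans
    (mul_le_mul_of_nonneg_left ?_ (by positivity))
  · refine add_nonneg (mul_nonneg (recentCoin_nonneg m b t) (I.staleCost_nonneg hD hη hα t t b e))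
      (mul_nonneg (by linarith) (add_nonneg (by split_ifs <;> norm_num)
        (Finset.sum_nonneg fun u _ => I.movement_nonneg u b e)))
  · rw [meanOverhead, meanOverhead, recentCoin_update h, I.staleCost_update h]
    congr 3
    refine Finset.sum_congr rfl fun u hu => I.movement_update ?_ b e c
    exact (Finset.mem_Ioc.1 hu).2.trans h
  · have h2 : ∀ t, coinExp I.T (I.T + m) ρ (I.meanOverhead m η α t)
        = coinExp I.T (I.T + m) ρ (fun b e => recentCoin m b t * I.staleCost m η α t t b e)
          + diameter M * ((if t + 1 < m then 1 else 0)
            + ∑ u ∈ Finset.Ioc (t - m) t, coinExp I.T (I.T + m) ρ (I.movement m η α u)) := by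
      intro t
      unfold meanOverhead
      rw [coinExp_add, coinExp_mul, coinExp_add, coinExp_const, coinExp_sum]
    simp only [h2]
    rw [Finset.sum_add_distrib, ← Finset.mul_sum, Finset.sum_add_distrib]
    have h3 := I.sum_coinExp_recentCoin_mul_le (n := I.T + m) (m := m) hD hη hα h0 h1
    have h4 := sum_window_le (fun u => coinExp_nonneg (T := I.T) (n := I.T + m) h0 h1
      (I.movement_nonneg (m := m) (η := η) (α := α) u)) I.T m
    have h5 : ∑ t ∈ Finset.Icc 1 I.T, (if t + 1 < m then (1 : ℝ) else 0) ≤ m := by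
      rw [← Finset.sum_filter, Finset.sum_const, nsmul_eq_mul, mul_one]
      have h6 : (Finset.Icc 1 I.T).filter (fun t => t + 1 < m) ⊆ Finset.Icc 1 m := fun t => by
        simp only [Finset.mem_filter, Finset.mem_Icc]; omega
      have h7 := Finset.card_le_card h6
      rw [Nat.card_Icc, Nat.add_sub_cancel] at h7
      exact_mod_cast h7
    set N := ∑ u ∈ Finset.Icc 1 I.T, coinExp I.T (I.T + m) ρ (I.movement m η α u)
    -- Since `2 m ρ ≤ 1/4`, the recent-coin part costs at most `6 D m N`; the switches in the last
    -- `m` steps add one more `D m N`.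
    have h8 : 4 * diameter M * m * (1 + 2 * m * ρ) * N ≤ 6 * diameter M * m * N := by
      have h9 : 4 * (1 + 2 * m * ρ) ≤ 6 := by nlinarith
      have h10 : 0 ≤ diameter M * m * N := by positivity
      nlinarith [mul_le_mul_of_nonneg_right h9 h10]
    have h11 := mul_le_mul_of_nonneg_left (add_le_add h5 h4) (show 0 ≤ diameter M by linarith)
    linarith

variable (hD : 1 ≤ diameter M) (hη : 0 ≤ η) (hα : 0 ≤ α) (hτ : IsRounding τ)
include hD hη hα hτ

theorem Input.isTransport_fractional (s t : ℕ) :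
    IsTransport (I.fractional m η α b e s) (I.fractional m η α b e t)
      (τ (I.fractional m η α b e s) (I.fractional m η α b e t)) :=
  hτ _ ⟨fun i => (I.fractional_pos hD hη hα s i).le, I.sum_fractional hD hη hα s⟩
    _ ⟨fun i => (I.fractional_pos hD hη hα t i).le, I.sum_fractional hD hη hα t⟩

theorem Input.roundingWeight_nonneg (a : ℕ → Fin ℓ) :
    0 ≤ I.roundingWeight m η α τ b e a :=
  mul_nonneg (I.fractional_pos hD hη hα 0 _).le <| Finset.prod_nonneg fun _ _ =>
    transition_nonneg (I.isTransport_fractional hD hη hα hτ _ _)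
      (fun i => I.fractional_pos hD hη hα _ i) _ _

theorem Input.sum_roundingWeight :
    ∑ a : Fin (I.T + 1) → Fin ℓ, I.roundingWeight m η α τ b e (fromZero a) = 1 :=
  sum_path_eq_one (x := I.fractional m η α b e)
    (fun t j => sum_mul_transition (I.isTransport_fractional hD hη hα hτ t (t + 1))
      (fun i => I.fractional_pos hD hη hα t i) j)
    (fun t => I.sum_fractional hD hη hα t) I.T

theorem Input.sum_roundingWeight_hcost {t : ℕ} (ht : t ∈ Finset.Icc 1 I.T) :
    ∑ a : Fin (I.T + 1) → Fin ℓ,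
        I.roundingWeight m η α τ b e (fromZero a) * I.hcost t (fromZero a t)
      = I.staleCost m η α t t b e := by
  rw [Finset.mem_Icc] at ht
  obtain ⟨s, rfl⟩ : ∃ s, t = s + 1 := ⟨t - 1, by omega⟩
  exact sum_path_single (x := I.fractional m η α b e)
    (fun t j => sum_mul_transition (I.isTransport_fractional hD hη hα hτ t (t + 1))
      (fun i => I.fractional_pos hD hη hα t i) j)
    (fun t i => sum_transition (I.isTransport_fractional hD hη hα hτ t (t + 1))
      (fun i => I.fractional_pos hD hη hα t i) i)
    (show s < I.T by omega) (I.hcost (s + 1))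

theorem Input.sum_roundingWeight_switchAt {t : ℕ} (ht : t ∈ Finset.Icc 1 I.T) :
    ∑ a : Fin (I.T + 1) → Fin ℓ,
        I.roundingWeight m η α τ b e (fromZero a) * switchAt (fromZero a) t
      = I.movement m η α t b e := by
  rw [Finset.mem_Icc] at ht
  obtain ⟨s, rfl⟩ : ∃ s, t = s + 1 := ⟨t - 1, by omega⟩
  rw [movement, Nat.add_sub_cancel,
    ← sum_switch_transition (I.isTransport_fractional hD hη hα hτ s (s + 1))
      (fun i => I.fractional_pos hD hη hα s i)]
  exact sum_path_pair (x := I.fractional m η α b e)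
    (fun t j => sum_mul_transition (I.isTransport_fractional hD hη hα hτ t (t + 1))
      (fun i => I.fractional_pos hD hη hα t i) j)
    (fun t i => sum_transition (I.isTransport_fractional hD hη hα hτ t (t + 1))
      (fun i => I.fractional_pos hD hη hα t i) i)
    (show s < I.T by omega) (fun i j => if i ≠ j then 1 else 0)

theorem Input.sum_roundingWeight_overhead {t : ℕ} (ht : t ∈ Finset.Icc 1 I.T) :
    ∑ a : Fin (I.T + 1) → Fin ℓ,
        I.roundingWeight m η α τ b e (fromZero a) * I.overhead m b (fromZero a) t
      = I.meanOverhead m η α t b e := by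
  have h1 : ∀ a : Fin (I.T + 1) → Fin ℓ,
      I.roundingWeight m η α τ b e (fromZero a) * I.overhead m b (fromZero a) t
      = recentCoin m b t *
          (I.roundingWeight m η α τ b e (fromZero a) * I.hcost t (fromZero a t))
        + diameter M * (I.roundingWeight m η α τ b e (fromZero a) * (if t + 1 < m then 1 else 0)
          + ∑ u ∈ Finset.Ioc (t - m) t,
            I.roundingWeight m η α τ b e (fromZero a) * switchAt (fromZero a) u) := fun a => by
    rw [overhead, unsettled, ← Finset.mul_sum]; ring
  simp only [h1]
  rw [Finset.sum_add_distrib, ← Finset.mul_sum, ← Finset.mul_sum, Finset.sum_add_distrib,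
    ← Finset.sum_mul, I.sum_roundingWeight hD hη hα hτ, one_mul, Finset.sum_comm,
    I.sum_roundingWeight_hcost hD hη hα hτ ht, meanOverhead]
  congr 3
  refine Finset.sum_congr rfl fun u hu => I.sum_roundingWeight_switchAt hD hη hα hτ ?_
  rw [Finset.mem_Icc] at ht ⊢
  rw [Finset.mem_Ioc] at hu
  omega

/-- The damping factors depend on the coins only. Given these, the debt is linear in the overhead,
so the conditional expectation passes through the recursion. -/
theorem Input.sum_roundingWeight_debt {t : ℕ} (ht : t ≤ I.T) :
    ∑ a : Fin (I.T + 1) → Fin ℓ,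
        I.roundingWeight m η α τ b e (fromZero a) * I.debt m b (fromZero a) t
      = I.meanDebt m η α t b e := by
  induction t with
  | zero => simp [debt, meanDebt, damped]
  | succ t ih =>
    have h1 : ∀ a : Fin (I.T + 1) → Fin ℓ,
        I.roundingWeight m η α τ b e (fromZero a) * I.debt m b (fromZero a) (t + 1)
        = recentCoin m b (t + 1) *
            (I.roundingWeight m η α τ b e (fromZero a) * I.debt m b (fromZero a) t)
          + I.roundingWeight m η α τ b e (fromZero a) * I.overhead m b (fromZero a) (t + 1) :=
      fun a => by simp only [debt, damped]; ring
    simp only [h1]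
    rw [Finset.sum_add_distrib, ← Finset.mul_sum, ih (by omega),
      I.sum_roundingWeight_overhead hD hη hα hτ (Finset.mem_Icc.2 ⟨by omega, ht⟩)]
    rfl

variable {greedy : ℕ → M → M} {ρ : ℝ}

theorem Input.expectedCost_le (hg : I.IsGreedy greedy) (h0 : 0 ≤ ρ) (h1 : ρ ≤ 1) :
    I.expectedCost m ρ η α τ greedy ≤ ENNReal.ofReal
      (∑ t ∈ Finset.Icc 1 I.T, coinExp I.T (I.T + m) ρ (I.staleCost m η α t t)
        + diameter M * ∑ t ∈ Finset.Icc 1 I.T, coinExp I.T (I.T + m) ρ (I.movement m η α t)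
        + 5 * ∑ t ∈ Finset.Icc 1 I.T, coinExp I.T (I.T + m) ρ (I.meanDebt m η α t)) := by
  let bound : (ℕ → Bool) → (ℕ → Fin ℓ) → ℝ := fun b a => ∑ t ∈ Finset.Icc 1 I.T,
      (I.hcost t (a t) + diameter M * switchAt a t + 5 * I.debt m b a t)
  have hb0 : ∀ b a, 0 ≤ bound b a := fun b a => Finset.sum_nonneg fun t _ => by
    have h2 := I.hcost_nonneg t (a t)
    have h3 := mul_nonneg (show 0 ≤ diameter M by linarith) (switchAt_nonneg a t)
    have h4 := I.debt_nonneg (m := m) (b := b) (a := a) hD t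
    linarith
  have hw : ∀ (β : Fin I.T → Bool) (e : Fin (I.T + m) → Fin ℓ) (a : Fin (I.T + 1) → Fin ℓ),
      0 ≤ I.prob m ρ η α τ β e a := fun β e a => by
    rw [prob_eq]
    exact mul_nonneg (coinWeight_nonneg h0 h1 β e) (I.roundingWeight_nonneg hD hη hα hτ _)
  have hmean : ∀ b e, ∑ a : Fin (I.T + 1) → Fin ℓ,
      I.roundingWeight m η α τ b e (fromZero a) * bound b (fromZero a)
      = ∑ t ∈ Finset.Icc 1 I.T, (I.staleCost m η α t t b e
        + diameter M * I.movement m η α t b e + 5 * I.meanDebt m η α t b e) := fun b e => by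
    simp only [bound, Finset.mul_sum]
    rw [Finset.sum_comm]
    refine Finset.sum_congr rfl fun t ht => ?_
    simp only [mul_add, Finset.sum_add_distrib, mul_left_comm _ (diameter M),
      mul_left_comm _ (5 : ℝ), ← Finset.mul_sum]
    rw [I.sum_roundingWeight_hcost hD hη hα hτ ht, I.sum_roundingWeight_switchAt hD hη hα hτ ht,
      I.sum_roundingWeight_debt hD hη hα hτ (Finset.mem_Icc.1 ht).2]
  have htotal : ∑ β : Fin I.T → Bool, ∑ e : Fin (I.T + m) → Fin ℓ, ∑ a : Fin (I.T + 1) → Fin ℓ,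
      I.prob m ρ η α τ β e a * bound (fromOne β) (fromZero a)
      = ∑ t ∈ Finset.Icc 1 I.T, coinExp I.T (I.T + m) ρ (I.staleCost m η α t t)
        + diameter M * ∑ t ∈ Finset.Icc 1 I.T, coinExp I.T (I.T + m) ρ (I.movement m η α t)
        + 5 * ∑ t ∈ Finset.Icc 1 I.T, coinExp I.T (I.T + m) ρ (I.meanDebt m η α t) := by
    simp only [prob_eq, mul_assoc, ← Finset.mul_sum, hmean]
    rw [Finset.mul_sum, Finset.mul_sum, ← Finset.sum_add_distrib, ← Finset.sum_add_distrib]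
    refine (coinExp_sum (T := I.T) (n := I.T + m) (ρ := ρ) (Finset.Icc 1 I.T)
      fun t b e => I.staleCost m η α t t b e
        + diameter M * I.movement m η α t b e + 5 * I.meanDebt m η α t b e).trans ?_
    refine Finset.sum_congr rfl fun t _ => ?_
    rw [coinExp_add, coinExp_add, coinExp_mul, coinExp_mul]
  rw [← htotal, ENNReal.ofReal_sum_of_nonneg fun β _ => Finset.sum_nonneg fun e _ =>
    Finset.sum_nonneg fun a _ => mul_nonneg (hw β e a) (hb0 _ _)]
  refine Finset.sum_le_sum fun β _ => ?_
  rw [ENNReal.ofReal_sum_of_nonneg fun e _ =>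
    Finset.sum_nonneg fun a _ => mul_nonneg (hw β e a) (hb0 _ _)]
  refine Finset.sum_le_sum fun e _ => ?_
  rw [ENNReal.ofReal_sum_of_nonneg fun a _ => mul_nonneg (hw β e a) (hb0 _ _)]
  refine Finset.sum_le_sum fun a _ => ?_
  rw [ENNReal.ofReal_mul (hw β e a)]
  exact mul_le_mul_right (I.algCost_le hg hD) _

end Rounded

/-! ### The choice of the parameters -/

/-! ### Combinations of heuristics as comparators. -/

section Comparator

variable {M : Type*} [MetricSpace M] {ℓ : ℕ} (I : Input M ℓ)

/-- The two costs differ only in the point from which the movement starts; a switch changes it by at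
most `D`. At time `1` there is no difference because all heuristics share the initial state. -/
theorem Input.sum_hcost_le (hD : 1 ≤ diameter M) (a : ℕ → Fin ℓ) :
    ENNReal.ofReal (∑ t ∈ Finset.Icc 1 I.T, I.hcost t (a t))
      ≤ I.combinationCost a + ENNReal.ofReal (switches I.T a * diameter M) := by
  have hsw : ENNReal.ofReal (switches I.T a * diameter M)
      = ∑ t ∈ Finset.Icc 1 I.T,
        if 2 ≤ t ∧ a (t - 1) ≠ a t then ENNReal.ofReal (diameter M) else 0 := by
    rw [← Finset.sum_filter, Finset.sum_const, nsmul_eq_mul,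
      ENNReal.ofReal_mul (Nat.cast_nonneg _), ENNReal.ofReal_natCast, switches]
    congr 3
    ext t
    simp only [Finset.mem_filter, Finset.mem_Icc]
    constructor
    · rintro ⟨⟨h1, h2⟩, h3⟩; exact ⟨⟨by omega, h2⟩, h1, h3⟩
    · rintro ⟨⟨h1, h2⟩, h3, h4⟩; exact ⟨⟨h3, h2⟩, h4⟩
  rw [ENNReal.ofReal_sum_of_nonneg fun t _ => I.hcost_nonneg t _, hsw, combinationCost,
    ← Finset.sum_add_distrib]
  refine Finset.sum_le_sum fun t ht => ?_
  rw [I.ofReal_hcost ht, heuristicCost, add_assoc]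
  gcongr
  split_ifs with h
  · refine (edist_triangle _ (I.state (t - 1) (a (t - 1))) _).trans ?_
    rw [add_comm]
    gcongr
    exact edist_le_diameter hD _ _
  · rw [add_zero]
    rcases Nat.lt_or_ge t 2 with h2 | h2
    · rw [show t - 1 = 0 by omega, I.state_zero, I.state_zero]
    · rw [not_and, not_not] at h
      rw [h h2]

theorem Input.exists_comparator (hD : 1 ≤ diameter M) {k : ℕ} (hO : 0 < I.opt k) :
    ∃ a : ℕ → Fin ℓ, switches I.T a ≤ k ∧
      ∑ t ∈ Finset.Icc 1 I.T, I.hcost t (a t) ≤ I.opt k + 1 + k * diameter M := by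
  have hne : (⨅ (a : ℕ → Fin ℓ) (_ : switches I.T a ≤ k), I.combinationCost a) ≠ ⊤ := by
    intro h
    rw [opt, h] at hO
    simp at hO
  -- A near-optimal combination suffices; the slack `1` is later absorbed by `γ O`.
  have hlt := ENNReal.lt_add_right hne one_ne_zero
  rw [iInf_lt_iff] at hlt
  obtain ⟨a, ha⟩ := hlt
  rw [iInf_lt_iff] at ha
  obtain ⟨hk, ha⟩ := ha
  refine ⟨a, hk, ?_⟩
  have h1 : I.combinationCost a ≤ ENNReal.ofReal (I.opt k + 1) := by
    rw [ENNReal.ofReal_add hO.le zero_le_one, ENNReal.ofReal_one, opt, ENNReal.ofReal_toReal hne]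
    exact ha.le
  have hk' : (switches I.T a : ℝ) ≤ k := by exact_mod_cast hk
  have h2 := (I.sum_hcost_le hD a).trans (add_le_add h1 (ENNReal.ofReal_le_ofReal
    (mul_le_mul_of_nonneg_right hk' (by linarith))))
  rw [← ENNReal.ofReal_add (by linarith) (by positivity)] at h2
  exact (ENNReal.ofReal_le_ofReal_iff (by positivity)).1 h2

end Comparator

/-! ### Algebra of the tuned parameters. -/

theorem rpow_third_pow {x : ℝ} (hx : 0 ≤ x) : (x ^ (1 / 3 : ℝ)) ^ 3 = x := by
  rw [← Real.rpow_natCast, ← Real.rpow_mul hx]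
  norm_num

section Parameters

variable {D O : ℝ} {ℓ m k : ℕ} (hD : 1 ≤ D) (hO : 0 < O) (hℓ : 1 ≤ ℓ) (hm : 1 ≤ m) (hk : 1 ≤ k)
include hD hO hℓ hm hk

theorem exploreRate_pos : 0 < exploreRate D ℓ m k O := by
  have h1 : (0 : ℝ) < ℓ := by exact_mod_cast hℓ
  have h2 : (0 : ℝ) < m := by exact_mod_cast hm
  have h3 : (0 : ℝ) < k := by exact_mod_cast hk
  unfold exploreRate
  positivity

/-- Cubing removes the fractional exponents; the later estimates of the exploration rate rely on
this polynomial identity. -/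
theorem exploreRate_pow : exploreRate D ℓ m k O ^ 3 * m ^ 4 * O = D * ℓ * k := by
  have h2 : (0 : ℝ) < m := by exact_mod_cast hm
  have h4 : (O ^ (-(1 / 3) : ℝ)) ^ 3 = O⁻¹ := by
    rw [← Real.rpow_natCast, ← Real.rpow_mul hO.le, ← Real.rpow_neg_one]
    norm_num
  have h5 : ((m : ℝ) ^ (-(4 / 3) : ℝ)) ^ 3 = ((m : ℝ) ^ 4)⁻¹ := by
    rw [← Real.rpow_natCast, ← Real.rpow_mul h2.le, ← Real.rpow_natCast, ← Real.rpow_neg h2.le]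
    norm_num
  unfold exploreRate
  rw [mul_pow, mul_pow, h4, h5, rpow_third_pow (by positivity)]
  field_simp

theorem shareParam_eq : shareParam D ℓ m k O = (exploreRate D ℓ m k O * m ^ 2) ^ 2 := by
  have h1 := exploreRate_pos hD hO hℓ hm hk
  unfold shareParam
  rw [← exploreRate_pow hD hO hℓ hm hk]
  field_simp

theorem gammaParam_eq : gammaParam D ℓ m k O = exploreRate D ℓ m k O * m ^ 2 := by
  have h1 := exploreRate_pos hD hO hℓ hm hk
  have h2 := shareParam_eq hD hO hℓ hm hk
  unfold shareParam at h2
  rw [gammaParam, h2, Real.sqrt_sq (by positivity)]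

omit hk in
omit hℓ in
theorem logArg_pow : logArg D ℓ m O ^ 3 = ℓ * O ^ 2 / (D ^ 2 * m ^ 4) := by
  have h2 : (0 : ℝ) < m := by exact_mod_cast hm
  have hD0 : 0 < D := by linarith
  have h3 : ∀ {x : ℝ}, 0 < x → (x ^ (2 / 3 : ℝ)) ^ 3 = x ^ 2 := fun hx => by
    rw [← Real.rpow_natCast, ← Real.rpow_mul hx.le, ← Real.rpow_natCast]
    norm_num
  have h5 : ((m : ℝ) ^ (4 / 3 : ℝ)) ^ 3 = (m : ℝ) ^ 4 := by
    rw [← Real.rpow_natCast, ← Real.rpow_mul h2.le, ← Real.rpow_natCast]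
    norm_num
  rw [logArg, div_pow, mul_pow, mul_pow, rpow_third_pow (Nat.cast_nonneg _), h3 hO, h3 hD0, h5]

omit hk in
theorem logArg_pos : 0 < logArg D ℓ m O := by
  have h1 : (0 : ℝ) < ℓ := by exact_mod_cast hℓ
  have h2 : (0 : ℝ) < m := by exact_mod_cast hm
  unfold logArg
  positivity

/-- After cubing, the left-hand side is the right-hand side divided by `k²`, so `Z` is the value of
`ℓ / α` at `k = 1`. -/
theorem div_shareParam_le_logArg : ℓ / shareParam D ℓ m k O ≤ logArg D ℓ m O := by
  have h1 : (1 : ℝ) ≤ ℓ := by exact_mod_cast hℓ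
  have h2 : (1 : ℝ) ≤ m := by exact_mod_cast hm
  have h3 : (1 : ℝ) ≤ k := by exact_mod_cast hk
  have hρ := exploreRate_pos hD hO hℓ hm hk
  have hp := exploreRate_pow hD hO hℓ hm hk
  rw [shareParam_eq hD hO hℓ hm hk]
  set ρ := exploreRate D ℓ m k O
  refine le_of_pow_le_pow_left₀ three_ne_zero (logArg_pos hD hO hℓ hm).le ?_
  rw [logArg_pow hD hO hm, div_pow, div_le_div_iff₀ (by positivity) (by positivity)]
  have h6 : ((ρ * m ^ 2) ^ 2) ^ 3 * O ^ 2 = (D * ℓ * k) ^ 2 * m ^ 4 := by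
    rw [← hp]; ring
  have h7 : (ℓ : ℝ) ^ 3 * (D ^ 2 * m ^ 4) * 1 ≤ ℓ ^ 3 * (D ^ 2 * m ^ 4) * k ^ 2 := by
    refine mul_le_mul_of_nonneg_left ?_ (by positivity)
    nlinarith
  calc (ℓ : ℝ) ^ 3 * (D ^ 2 * m ^ 4) ≤ ℓ ^ 3 * (D ^ 2 * m ^ 4) * k ^ 2 := by linarith
    _ = ℓ * ((D * ℓ * k) ^ 2 * m ^ 4) := by ring
    _ = ℓ * O ^ 2 * ((ρ * m ^ 2) ^ 2) ^ 3 := by rw [← h6]; ring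

omit hk in
theorem four_le_logArg (h : D * ℓ * m ≤ 1 / 2 * O ^ (1 / 3 : ℝ)) : 4 ≤ logArg D ℓ m O := by
  have h1 : (1 : ℝ) ≤ ℓ := by exact_mod_cast hℓ
  have h2 : (1 : ℝ) ≤ m := by exact_mod_cast hm
  have hD0 : 0 < D := by linarith
  refine le_of_pow_le_pow_left₀ three_ne_zero (logArg_pos hD hO hℓ hm).le ?_
  rw [logArg_pow hD hO hm, le_div_iff₀ (by positivity)]
  have h3 : (8 * (D * ℓ * m) ^ 3) ^ 2 ≤ O ^ 2 := by
    have h4 := pow_le_pow_left₀ (by positivity) h 3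
    rw [mul_pow (1 / 2 : ℝ), rpow_third_pow hO.le] at h4
    exact pow_le_pow_left₀ (by positivity) (by linarith) 2
  have h5 : D ^ 2 * m ^ 4 * 1 ≤ D ^ 2 * m ^ 4 * (D ^ 4 * ℓ ^ 7 * m ^ 2) := by
    refine mul_le_mul_of_nonneg_left ?_ (by positivity)
    exact one_le_mul_of_one_le_of_one_le
      (one_le_mul_of_one_le_of_one_le (one_le_pow₀ hD) (one_le_pow₀ h1)) (one_le_pow₀ h2)
  calc (4 : ℝ) ^ 3 * (D ^ 2 * m ^ 4) ≤ ℓ * (8 * (D * ℓ * m) ^ 3) ^ 2 := by nlinarith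
    _ ≤ ℓ * O ^ 2 := by gcongr

/-- In the form `D m² ≤ γ O`, this lets `γ O` absorb the start-up overhead. -/
theorem exploreRate_mul_ge (h : D * ℓ * m ≤ 1 / 2 * O ^ (1 / 3 : ℝ)) :
    D * m ^ 2 ≤ exploreRate D ℓ m k O * m ^ 2 * O := by
  have h1 : (1 : ℝ) ≤ ℓ := by exact_mod_cast hℓ
  have h2 : (1 : ℝ) ≤ m := by exact_mod_cast hm
  have h3 : (1 : ℝ) ≤ k := by exact_mod_cast hk
  have hρ := exploreRate_pos hD hO hℓ hm hk
  have hp := exploreRate_pow hD hO hℓ hm hk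
  set ρ := exploreRate D ℓ m k O
  have hD0 : 0 < D := by linarith
  have h4 := pow_le_pow_left₀ (by positivity) h 3
  rw [mul_pow (1 / 2 : ℝ), rpow_third_pow hO.le] at h4
  refine le_of_pow_le_pow_left₀ three_ne_zero (by positivity) ?_
  have h5 : (ρ * m ^ 2 * O) ^ 3 = D * ℓ * k * m ^ 2 * O ^ 2 := by rw [← hp]; ring
  have h6 : ((D * ℓ * m) ^ 3) ^ 2 ≤ O ^ 2 := pow_le_pow_left₀ (by positivity) (by linarith) 2
  have h7 : (D * m ^ 2) ^ 3 * 1 ≤ (D * m ^ 2) ^ 3 * (D ^ 4 * ℓ ^ 7 * k * m ^ 2) := by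
    refine mul_le_mul_of_nonneg_left ?_ (by positivity)
    exact one_le_mul_of_one_le_of_one_le (one_le_mul_of_one_le_of_one_le
      (one_le_mul_of_one_le_of_one_le (one_le_pow₀ hD) (one_le_pow₀ h1)) h3) (one_le_pow₀ h2)
  calc (D * m ^ 2) ^ 3 ≤ D * ℓ * k * m ^ 2 * ((D * ℓ * m) ^ 3) ^ 2 := by nlinarith
    _ ≤ D * ℓ * k * m ^ 2 * O ^ 2 := by gcongr
    _ = _ := h5.symm

end Parameters

theorem log_inv_one_sub_le {γ : ℝ} (h0 : 0 ≤ γ) (h1 : γ ≤ 1 / 2) :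
    Real.log (1 / (1 - γ)) ≤ γ * (1 + 2 * γ) := by
  have h2 : 0 < 1 - γ := by linarith
  refine (Real.log_le_sub_one_of_pos (by positivity)).trans ?_
  rw [div_sub_one h2.ne', div_le_iff₀ h2]
  nlinarith [mul_nonneg h0 h0, mul_nonneg (mul_nonneg h0 h0) (sub_nonneg.2 h1)]

/-- The combination of the bounds on the regret, the movement, the cost of the fractional
solution, and the overhead of the algorithm. -/
theorem competitive_bound {D ℓ m k s ρ γ η O F L lam A N C G P : ℝ} (hD : 1 ≤ D) (hℓ : 1 ≤ ℓ)
    (hm : 1 ≤ m) (hk : 1 ≤ k) (hs : s ≤ k) (hρ : 0 < ρ) (hO : 0 < O)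
    (hγ : γ = ρ * m ^ 2) (hγO : ρ ^ 3 * m ^ 4 * O = D * ℓ * k) (hDm : D * m ^ 2 ≤ γ * O)
    (hη0 : 0 ≤ η) (hη : η ≤ γ * (1 + 2 * γ)) (hlam : 1 ≤ lam) (hg : γ * lam ≤ 1 / 210)
    (hL0 : 0 ≤ L) (hL : L ≤ 2 * lam) (hF : F ≤ O + 1 + k * D) (hA0 : 0 ≤ A) (hN0 : 0 ≤ N)
    (hA : (1 - γ ^ 2) * γ * (1 / (2 * D * ℓ)) * A
      ≤ η * (1 / (2 * D * ℓ)) * ρ * F + (s + 2) * L)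
    (hN : N ≤ η * (1 / (2 * D * ℓ)) * A)
    (hC0 : 0 ≤ C)
    (hC : ρ * (1 - ρ * m) * C ≤ A + 8 * D * m * ρ * N + ρ * (2 * D * m))
    (hP : P ≤ 10 * m * (2 * m * ρ * C + 7 * D * m * N + D * m))
    (hG : G ≤ C + D * N + 5 * P) :
    G ≤ (1 + 210 * (γ * lam)) * O := by
  have hγ0 : 0 < γ := by rw [hγ]; positivity
  set g := γ * lam with hgdef
  have hγg : γ ≤ g := le_mul_of_one_le_right hγ0.le hlam
  have hm2 : m ≤ m ^ 2 := le_self_pow₀ hm two_ne_zero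
  have hm2' : 1 ≤ m ^ 2 := one_le_pow₀ hm
  have hg0 : 0 < g := by positivity
  have hg2 : g * g ≤ 1 / 210 * g := by gcongr
  have hγ2 : γ * γ ≤ 1 / 210 * γ := by gcongr; linarith
  have hgO : 0 < g * O := by positivity
  have hγO' : γ * O ≤ g * O := by gcongr
  have hγγ : γ ^ 2 * O ≤ 1 / 210 * (g * O) := by
    calc γ ^ 2 * O = γ * (γ * O) := by ring
      _ ≤ 1 / 210 * (g * O) := mul_le_mul (hγg.trans hg) hγO' (by positivity) (by norm_num)
  have hkD : k * D ≤ γ * O := by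
    have h1 : D * k * (ℓ * m ^ 2) = γ ^ 3 * O := by
      calc D * k * (ℓ * m ^ 2) = D * ℓ * k * m ^ 2 := by ring
        _ = γ ^ 3 * O := by rw [← hγO, hγ]; ring
    have h2 : 1 ≤ ℓ * m ^ 2 := one_le_mul_of_one_le_of_one_le hℓ hm2'
    have h3 : γ ^ 2 ≤ 1 := pow_le_one₀ hγ0.le (by linarith)
    have h4 : 0 ≤ D * k := by positivity
    have h5 : γ ^ 3 * O ≤ γ * O := by
      calc γ ^ 3 * O = γ ^ 2 * (γ * O) := by ring
        _ ≤ 1 * (γ * O) := by gcongr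
        _ = γ * O := one_mul _
    linarith [mul_le_mul_of_nonneg_left h2 h4]
  have h1O : 1 ≤ γ * O := (one_le_mul_of_one_le_of_one_le hD hm2').trans hDm
  have hF' : F ≤ O + 2 * (γ * O) := by linarith
  have hAρ : (1 - γ ^ 2) * A ≤ ρ * ((1 + 17 * g) * O) := by
    have h1 : (1 - γ ^ 2) * γ * A ≤ η * ρ * F + 2 * D * ℓ * ((s + 2) * L) := by
      have h2 := mul_le_mul_of_nonneg_left hA (show 0 ≤ 2 * D * ℓ by positivity)
      have h3 : 2 * D * ℓ * ((1 - γ ^ 2) * γ * (1 / (2 * D * ℓ)) * A)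
          = (1 - γ ^ 2) * γ * A := by field_simp
      have h4 : 2 * D * ℓ * (η * (1 / (2 * D * ℓ)) * ρ * F + (s + 2) * L)
          = η * ρ * F + 2 * D * ℓ * ((s + 2) * L) := by field_simp
      rwa [h3, h4] at h2
    -- The logarithmic regret: `D ℓ k = ρ γ² O`, so after division by `γ ρ` it is a multiple of `γ
    -- lam O`. This is where the logarithm enters the error.
    have h5 : 2 * D * ℓ * ((s + 2) * L) ≤ γ * ρ * (12 * (g * O)) := by
      have h6 : (s + 2) * L ≤ 3 * k * (2 * lam) :=
        mul_le_mul (by linarith) hL hL0 (by positivity)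
      calc 2 * D * ℓ * ((s + 2) * L) ≤ 2 * D * ℓ * (3 * k * (2 * lam)) := by gcongr
        _ = 12 * (D * ℓ * k) * lam := by ring
        _ = γ * ρ * (12 * (g * O)) := by rw [← hγO, hgdef, hγ]; ring
    have h6 : η * ρ * F ≤ γ * ρ * ((1 + 2 * γ) * (O + 2 * (γ * O))) := by
      calc η * ρ * F ≤ η * ρ * (O + 2 * (γ * O)) := by gcongr
        _ ≤ γ * (1 + 2 * γ) * ρ * (O + 2 * (γ * O)) := by gcongr
        _ = _ := by ring
    have h7 : γ * ((1 - γ ^ 2) * A) ≤ γ * (ρ * ((1 + 17 * g) * O)) := by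
      have h8 : (1 + 2 * γ) * (O + 2 * (γ * O)) + 12 * (g * O) ≤ (1 + 17 * g) * O := by
        linarith
      have h9 := mul_le_mul_of_nonneg_left h8 (show 0 ≤ γ * ρ by positivity)
      linarith
    exact le_of_mul_le_mul_left h7 hγ0
  have hA' : A ≤ ρ * ((1 + 20 * g) * O) := by
    have h1 : γ ^ 2 ≤ g := (pow_le_of_le_one hγ0.le (by linarith) two_ne_zero).trans hγg
    have h2 : (1 - g) * A ≤ ρ * ((1 + 17 * g) * O) :=
      (mul_le_mul_of_nonneg_right (by linarith) hA0).trans hAρ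
    have h3 : 1 + 17 * g ≤ (1 - g) * (1 + 20 * g) := by linarith
    have h4 : ρ * ((1 + 17 * g) * O) ≤ (1 - g) * (ρ * ((1 + 20 * g) * O)) := by
      have := mul_le_mul_of_nonneg_right h3 (show 0 ≤ ρ * O by positivity)
      linarith
    exact le_of_mul_le_mul_left (h2.trans h4) (by linarith)
  have hN' : D * m ^ 2 * N ≤ 2 * (γ ^ 2 * O) := by
    have h1 : η ≤ 2 * γ := by linarith
    have h2 : A ≤ 2 * (ρ * O) := by
      calc A ≤ ρ * ((1 + 20 * g) * O) := hA'
        _ ≤ ρ * (2 * O) := by gcongr; linarith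
        _ = 2 * (ρ * O) := by ring
    have h3 : η * (1 / (2 * D * ℓ)) * A ≤ 2 * γ * (1 / (2 * D * 1)) * (2 * (ρ * O)) := by
      gcongr
    calc D * m ^ 2 * N ≤ D * m ^ 2 * (2 * γ * (1 / (2 * D * 1)) * (2 * (ρ * O))) := by
          gcongr
          exact hN.trans h3
      _ = 2 * (γ ^ 2 * O) := by rw [hγ]; field_simp
  have hDN : D * N ≤ D * m ^ 2 * N := by
    rw [mul_right_comm]
    exact le_mul_of_one_le_right (by positivity) hm2'
  have hDmN : D * m * N ≤ D * m ^ 2 * N := by gcongr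
  have hDm' : D * m ≤ D * m ^ 2 := by gcongr
  have hρm : ρ * m ≤ g := by
    have : ρ * m ≤ ρ * m ^ 2 := by gcongr
    linarith
  have hC' : C ≤ (1 + 26 * g) * O := by
    have h1 : ρ * ((1 - ρ * m) * C) ≤ ρ * ((1 + 20 * g) * O + 8 * (D * m * N) + 2 * (D * m)) := by
      linarith
    have h2 := le_of_mul_le_mul_left h1 hρ
    have h3 : (1 - g) * C ≤ (1 + 23 * g) * O := by
      have : (1 - g) * C ≤ (1 - ρ * m) * C := by gcongr
      linarith
    have h4 : 1 + 23 * g ≤ (1 - g) * (1 + 26 * g) := by linarith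
    have h5 : (1 + 23 * g) * O ≤ (1 - g) * ((1 + 26 * g) * O) := by
      linarith [mul_le_mul_of_nonneg_right h4 hO.le]
    exact le_of_mul_le_mul_left (h3.trans h5) (by linarith)
  have hP' : P ≤ 20 * (γ * C) + 70 * (D * m ^ 2 * N) + 10 * (D * m ^ 2) := by
    rw [hγ]; linarith
  have hγC : γ * C ≤ g * ((1 + 26 * g) * O) := mul_le_mul hγg hC' hC0 (by positivity)
  have hgg : g * (g * O) ≤ 1 / 210 * (g * O) := by gcongr
  -- Beyond `O`, the terms of order `g O` have coefficients `26` from `C`, `100` from `γ C` and `50`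
  -- from the start-up; the products of small quantities are below `20`, so `210` suffices.
  linarith

end MTS

end

/-! ### The main theorem. -/

theorem mainTheorem6 :
    ∃ c₀ : ℝ, 0 < c₀ ∧ ∃ c : ℝ, 0 < c ∧
      ∀ (M : Type*) [MetricSpace M] (ℓ : ℕ) [NeZero ℓ] (m k : ℕ) (I : MTS.Input M ℓ)
        (greedy : ℕ → M → M) (τ : (Fin ℓ → ℝ) → (Fin ℓ → ℝ) → Fin ℓ → Fin ℓ → ℝ) (ε : ℝ),
        2 ≤ m → 1 ≤ k → 0 < ε → ε ≤ 1 →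
        I.IsGreedy greedy → MTS.IsRounding τ →
        1 ≤ MTS.diameter M →
        MTS.diameter M * ℓ * m ≤ c₀ * I.opt k ^ (1 / 3 : ℝ) →
        (k : ℝ) ≤ c * (ε ^ 3 * I.opt k /
          (MTS.diameter M * ℓ * m ^ 2 *
            Real.log (MTS.logArg (MTS.diameter M) ℓ m (I.opt k)) ^ 3)) →
        (MTS.exploreRate (MTS.diameter M) ℓ m k (I.opt k) ∈ Set.Ioc (0 : ℝ) 1 ∧
          MTS.shareParam (MTS.diameter M) ℓ m k (I.opt k) ∈ Set.Ioc (0 : ℝ) (1 / 2) ∧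
          0 < MTS.learningRate (MTS.diameter M) ℓ m k (I.opt k)) ∧
        I.expectedCost m
            (MTS.exploreRate (MTS.diameter M) ℓ m k (I.opt k))
            (MTS.learningRate (MTS.diameter M) ℓ m k (I.opt k))
            (MTS.shareParam (MTS.diameter M) ℓ m k (I.opt k)) τ greedy
          ≤ ENNReal.ofReal ((1 + ε) * I.opt k) := by
  refine ⟨1 / 2, by norm_num, (1 / 210) ^ 3, by norm_num, ?_⟩
  intro M _ ℓ _ m k I greedy τ ε hm2 hk hε hε1 hg hτ hD hreg hkc
  have hℓ : 1 ≤ ℓ := NeZero.one_le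
  have hm : 1 ≤ m := by omega
  have hℓ' : (1 : ℝ) ≤ ℓ := by exact_mod_cast hℓ
  have hm' : (1 : ℝ) ≤ m := by exact_mod_cast hm
  have hk' : (1 : ℝ) ≤ k := by exact_mod_cast hk
  have hD0 : 0 < MTS.diameter M := by linarith
  -- A vanishing benchmark contradicts the regime assumption; this also rules out an infinite
  -- infimum, whose real value would be `0`.
  have hO : 0 < I.opt k := by
    have h0 : 0 ≤ I.opt k := ENNReal.toReal_nonneg
    refine lt_of_le_of_ne h0 fun h => ?_
    rw [← h, Real.zero_rpow (by norm_num), mul_zero] at hreg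
    have : 0 < MTS.diameter M * ℓ * m := by positivity
    linarith
  obtain ⟨a, hsw, hF⟩ := I.exists_comparator hD hO
  have hρ := MTS.exploreRate_pos hD hO hℓ hm hk
  have hp := MTS.exploreRate_pow hD hO hℓ hm hk
  have hDm := MTS.exploreRate_mul_ge hD hO hℓ hm hk hreg
  have hZ := MTS.four_le_logArg hD hO hℓ hm hreg
  have hdiv := MTS.div_shareParam_le_logArg hD hO hℓ hm hk
  have hγ := MTS.gammaParam_eq hD hO hℓ hm hk
  rw [MTS.learningRate, hγ]
  rw [MTS.shareParam_eq hD hO hℓ hm hk] at hdiv ⊢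
  set D := MTS.diameter M
  set O := I.opt k
  set ρ := MTS.exploreRate D ℓ m k O
  set γ := ρ * m ^ 2 with hγdef
  set Z := MTS.logArg D ℓ m O
  have hγ0 : 0 < γ := by positivity
  have hlam : 1 ≤ Real.log Z := by
    rw [Real.le_log_iff_exp_le (by linarith)]
    linarith [Real.exp_one_lt_d9]
  -- The bound on `k` is the cube of this inequality, which explains the constant `(1 / 210) ^ 3`.
  have hglam : γ * Real.log Z ≤ 1 / 210 * ε := by
    refine le_of_pow_le_pow_left₀ three_ne_zero (by positivity) ?_
    have h1 : 0 < D * ℓ * m ^ 2 * Real.log Z ^ 3 := by positivity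
    rw [← mul_div_assoc, le_div_iff₀ h1] at hkc
    have h2 : (γ * Real.log Z) ^ 3 * O = k * (D * ℓ * m ^ 2 * Real.log Z ^ 3) := by
      calc (γ * Real.log Z) ^ 3 * O = ρ ^ 3 * m ^ 4 * O * m ^ 2 * Real.log Z ^ 3 := by
            rw [hγdef]; ring
        _ = _ := by rw [hp]; ring
    refine le_of_mul_le_mul_right ?_ hO
    rw [h2]
    linarith
  have hγ1 : γ ≤ 1 / 210 := by
    linarith [le_mul_of_one_le_right hγ0.le hlam]
  have hα0 : 0 < γ ^ 2 := by positivity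
  have hα1 : γ ^ 2 ≤ 1 / 2 := by
    linarith [pow_le_of_le_one hγ0.le (by linarith) two_ne_zero]
  have hη : 0 < Real.log (1 / (1 - γ)) :=
    Real.log_pos ((one_lt_div (by linarith)).2 (by linarith))
  have hη' := MTS.log_inv_one_sub_le hγ0.le (by linarith)
  have hexp : 1 - Real.exp (-Real.log (1 / (1 - γ))) = γ := by
    rw [← Real.log_inv, one_div, inv_inv, Real.exp_log (by linarith)]
    ring
  set η := Real.log (1 / (1 - γ))
  have hργ : ρ ≤ γ := le_mul_of_one_le_right hρ.le (one_le_pow₀ hm')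
  have hρ1 : ρ ≤ 1 := by linarith
  have hρm : ρ * (4 * m + 1) ≤ 1 / 2 := by
    have h1 : 4 * (m : ℝ) + 1 ≤ 5 * m ^ 2 := by
      linarith [le_self_pow₀ hm' two_ne_zero, one_le_pow₀ hm' (n := 2)]
    have := mul_le_mul_of_nonneg_left h1 hρ.le
    linarith
  refine ⟨⟨⟨hρ, hρ1⟩, ⟨hα0, hα1⟩, hη⟩, ?_⟩
  refine (I.expectedCost_le hD hη.le hα0.le hτ hg hρ.le hρ1).trans
    (ENNReal.ofReal_le_ofReal ?_)
  have hreg' := I.coinExp_regret (m := m) hD hη.le hρ.le hρ1 hα0 (by linarith) a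
  rw [hexp] at hreg'
  have hL0 : 0 ≤ Real.log (2 * ℓ / γ ^ 2) :=
    Real.log_nonneg ((one_le_div hα0).2 (by linarith))
  -- `ℓ / α ≤ Z` and `2 ≤ Z` together give `2 ℓ / α ≤ Z²`.
  have hL : Real.log (2 * ℓ / γ ^ 2) ≤ 2 * Real.log Z := by
    have h1 : 2 * Real.log Z = Real.log (Z ^ 2) := by rw [Real.log_pow]; norm_num
    rw [h1]
    refine Real.log_le_log (by positivity) ?_
    calc 2 * ℓ / γ ^ 2 = 2 * (ℓ / γ ^ 2) := mul_div_assoc _ _ _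
      _ ≤ Z * Z := by gcongr; linarith
      _ = Z ^ 2 := (sq Z).symm
  have hfinal := MTS.competitive_bound (s := MTS.switches I.T a) hD hℓ' hm' hk'
    (by exact_mod_cast hsw) hρ hO hγdef hp hDm hη.le hη' hlam (by linarith) hL0 hL hF
    (Finset.sum_nonneg fun t _ => MTS.coinExp_nonneg hρ.le hρ1
      (I.exploreCost_nonneg hD hη.le hα0.le t))
    (Finset.sum_nonneg fun t _ => MTS.coinExp_nonneg hρ.le hρ1 (I.movement_nonneg t))
    hreg' (I.coinExp_movement_le hD hη.le hα0.le hρ.le hρ1 (by linarith))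
    (Finset.sum_nonneg fun t _ => MTS.coinExp_nonneg hρ.le hρ1
      (I.staleCost_nonneg hD hη.le hα0.le t t))
    (I.sum_coinExp_staleCost_le hD hη.le hα0.le hρ.le hρ1 hm)
    (I.sum_meanDebt_le hD hη.le hα0.le hρ.le hρ1 hm hρm) le_rfl
  refine hfinal.trans (mul_le_mul_of_nonneg_right ?_ hO.le)
  linarith
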